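/- Let $X$ be a finite set. For $c\subseteq X\times X$ let $A_c$ be its $0/1$ adjacency matrix and $c^*=\{(y,x):(x,y)\in c\}$. A \emph{homogeneous coherent configuration} $(X,C)$ is a partition $C$ of $X\times X$ into non-empty sets, closed under $c\mapsto c^*$, containing the diagonal, such that $\mathbb{C}C=\bigoplus_{c\in C}\mathbb{C}A_c$ is a subalgebra of $M_X(\mathbb{C})$; for a \emph{coherent configuration} the diagonal is only required to be a union of members of $C$. A matrix $W\in M_X(\mathbb{C})$ is a \emph{weight} on a coherent configuration $(X,C)$ if (W1) its support $\operatorname{spt}(W)=\{(x,y):W_{xy}\neq 0\}$ is a union of members of $C$, and $d\subseteq\operatorname{spt}(W)$ implies $d^*\subseteq\operatorname{spt}(W)$ for $d\in C$; (W2) $W_{xx}\ne 0$ for all $x$; (W3) the span of the entrywise products $A_c\circ W$, $c\in C$, is a subalgebra of $M_X(\mathbb{C})$. (Subalgebras contain the identity matrix.) Let $(X,C)$ be a homogeneous coherent configuration and let $D\subseteq C$ be a closed subset, that is, $\mathbb{C}D=\bigoplus_{d\in D}\mathbb{C}A_d$ is a subalgebra of $\mathbb{C}C$. Put $xD=\{y:(x,y)\in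 d\text{ for some }d\in D\}$, $X/D=\{xD:x\in X\}$, $c^D=\{(S,T)\in (X/D)^2: c\cap(S\times T)\neq\emptyset\}$ and $C/\!/D=\{c^D:c\in C\}$. Let $\varphi$ be an irreducible character of $\mathbb{C}D$ of multiplicity one, meaning that it occurs with multiplicity one in the standard module $\mathbb{C}(xD)$ of the sub-configuration on $xD$ for some (equivalently, every) $x\in X$. Then: (a) $(X/D,C/\!/D)$ is a homogeneous coherent configuration. (b) There is a unique central primitive idempotent $e_\varphi$ of $\mathbb{C}D$ corresponding to $\varphi$ (that is, with $\varphi(e_\varphi)\neq 0$), and the members of $X/D$ can be ordered, as $S=\{S_1,\dots,S_\ell\}$ for $S\in X/D$, so that all diagonal blocks of $e_\varphi$ are one and the same matrix $e\in M_\ell(\mathbb{C})$. (c) For every such choice of orderings, each block of each $M\in e_\varphi M_X(\mathbb{C})e_\varphi$ is a unique scalar multiple of $e$, say $(M_{S_s,T_t})_{s,t}=\Gamma(M)_{S,T}\,e$, and $\Gamma:e_\varphi M_X(\mathbb{C})e_\varphi\to M_{X/D}(\mathbb{C})$ is a homomorphism of unital algebras. (d) For every such choice of orderings and every family $(c_\lambda)_{\lambda\in\Lambda}$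 in $C$ such that $\lambda\mapsto c_\lambda^D$ is a bijection from $\Lambda$ to $C/\!/D$ and such that $e_\varphi A_{c_\lambda}e_\varphi\neq 0$ whenever some $c\in C$ with $c^D=c_\lambda^D$ satisfies $e_\varphi A_c e_\varphi\ne 0$, the matrix $$W=\sum_{\lambda\in\Lambda}\Gamma(e_\varphi A_{c_\lambda}e_\varphi)$$ is a weight on $(X/D,C/\!/D)$. -/

import Mathlib

namespace CohConf

universe u

section Basic

variable {X : Type u}

/-- The transposed relation `c* = {(y, x) | (x, y) ∈ c}`. -/
def transp (c : Set (X × X)) : Set (X × X) := {p | (p.2, p.1) ∈ c}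

open Classical in
/-- The adjacency matrix `A_c` of a relation `c ⊆ X × X`. -/
noncomputable def adj (c : Set (X × X)) : Matrix X X ℂ :=
  Matrix.of fun x y => if (x, y) ∈ c then 1 else 0

variable [Fintype X] [DecidableEq X]

/-- The linear span of a set of matrices is a (unital) subalgebra of the matrix algebra. -/
def SpanIsAlgebra (S : Set (Matrix X X ℂ)) : Prop :=
  ∃ B : Subalgebra ℂ (Matrix X X ℂ), Subalgebra.toSubmodule B = Submodule.span ℂ S

/-- `(X, C)` is a coherent configuration. -/
structure IsCoherent (C : Set (Set (X × X))) : Prop where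
  partition : Setoid.IsPartition C
  transp_mem : ∀ c ∈ C, transp c ∈ C
  diagonal : ∃ Δ ⊆ C, ⋃₀ Δ = Set.diagonal X
  algebra : SpanIsAlgebra (adj '' C)

/-- `(X, C)` is a homogeneous coherent configuration: the set `Δ ⊆ C` with union the diagonal is a
singleton, that is, the diagonal itself is a member of `C`. -/
structure IsHomogeneous (C : Set (Set (X × X))) : Prop extends IsCoherent C where
  diagonal_mem : Set.diagonal X ∈ C

/-- The support of a matrix. -/
def spt (W : Matrix X X ℂ) : Set (X × X) := {p | W p.1 p.2 ≠ 0}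

/-- `W` is a weight on the coherent configuration `(X, C)`. -/
structure IsWeight (C : Set (Set (X × X))) (W : Matrix X X ℂ) : Prop where
  spt_eq : ∃ E ⊆ C, spt W = ⋃₀ E
  spt_transp : ∀ d ∈ C, d ⊆ spt W → transp d ⊆ spt W
  diag_ne : ∀ x, W x x ≠ 0
  algebra : SpanIsAlgebra ((fun c => Matrix.hadamard (adj c) W) '' C)

/-- `D` is a closed subset of `C`: the span `ℂD` of the `A_d`, `d ∈ D`, is a subalgebra. -/
def IsClosedSubset (C D : Set (Set (X × X))) : Prop :=
  D ⊆ C ∧ SpanIsAlgebra (adj '' D)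

/-- The algebra `ℂD` generated by the `A_d`, `d ∈ D`. For a closed subset `D` this is the linear
span of these matrices. -/
noncomputable def adjAlgebra (D : Set (Set (X × X))) : Subalgebra ℂ (Matrix X X ℂ) :=
  Algebra.adjoin ℂ (adj '' D)

end Basic

section Factor

variable {X : Type u}

/-- `xD = {y | (x, y) ∈ d for some d ∈ D}`. -/
def coset (D : Set (Set (X × X))) (x : X) : Set X := {y | ∃ d ∈ D, (x, y) ∈ d}

/-- `X/D = {xD | x ∈ X}`. -/
def Cosets (D : Set (Set (X × X))) : Type u := {S : Set X // ∃ x, S = coset D x}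

noncomputable instance Cosets.instFintype [Finite X] (D : Set (Set (X × X))) :
    Fintype (Cosets D) :=
  have : Finite (Cosets D) := inferInstanceAs (Finite {S : Set X // ∃ x, S = coset D x})
  Fintype.ofFinite _

noncomputable instance Cosets.instDecidableEq (D : Set (Set (X × X))) :
    DecidableEq (Cosets D) := Classical.decEq _

/-- `c^D`: the pairs `(S, T)` of members of `X/D` such that `c` meets `S × T`. -/
def factorRel (D : Set (Set (X × X))) (c : Set (X × X)) : Set (Cosets D × Cosets D) :=
  {p | (c ∩ p.1.1 ×ˢ p.2.1).Nonempty}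

/-- `C//D = {c^D | c ∈ C}`. -/
def factor (C D : Set (Set (X × X))) : Set (Set (Cosets D × Cosets D)) := factorRel D '' C

end Factor

section Characters

variable {R : Type u} [Ring R] [Algebra ℂ R]

/-- `ρ` is an irreducible matrix representation: it has positive degree, and no invariant subspaces
other than `0` and the whole space. -/
def IsIrreducibleRep {n : ℕ} (ρ : R →ₐ[ℂ] Matrix (Fin n) (Fin n) ℂ) : Prop :=
  n ≠ 0 ∧ ∀ U : Submodule ℂ (Fin n → ℂ),
    (∀ a, ∀ v ∈ U, Matrix.mulVec (ρ a) v ∈ U) → U = ⊥ ∨ U = ⊤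

/-- `ρ` affords the character `φ`. -/
def Affords {n : ℕ} (ρ : R →ₐ[ℂ] Matrix (Fin n) (Fin n) ℂ) (φ : R → ℂ) : Prop :=
  ∀ a, φ a = (ρ a).trace

/-- `φ` is an irreducible character of the algebra `R`. -/
def IsIrreducibleCharacter (φ : R → ℂ) : Prop :=
  ∃ (n : ℕ) (ρ : R →ₐ[ℂ] Matrix (Fin n) (Fin n) ℂ), IsIrreducibleRep ρ ∧ Affords ρ φ

/-- `e` is a central primitive idempotent of `R`. -/
structure IsCentralPrimitiveIdempotent (e : R) : Prop where
  idem : e * e = e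
  central : ∀ a, e * a = a * e
  ne_zero : e ≠ 0
  primitive : ∀ f : R, f * f = f → (∀ a, f * a = a * f) → f * e = f → f = 0 ∨ f = e

/-- `e` is the central primitive idempotent `e_φ` that corresponds to the irreducible character
`φ`, that is, the one on which `φ` does not vanish. -/
def IsIdempotentOf (φ : R → ℂ) (e : R) : Prop :=
  IsCentralPrimitiveIdempotent e ∧ φ e ≠ 0

variable {X : Type u} [Fintype X] [DecidableEq X]

/-- The space of `ℂD`-homomorphisms from the module of the representation `ρ` of `ℂD` to the
standard module `ℂ(xD)` of the sub-configuration on `xD`. The elements of `ℂ(xD)` are viewed as the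
vectors in `ℂX` that are supported in `xD`, so that a homomorphism is a matrix with rows indexed
by `X`. -/
def homToStandard (D : Set (Set (X × X))) (x : X) {n : ℕ}
    (ρ : adjAlgebra D →ₐ[ℂ] Matrix (Fin n) (Fin n) ℂ) : Submodule ℂ (Matrix X (Fin n) ℂ) where
  carrier := {T | (∀ y ∉ coset D x, ∀ k, T y k = 0) ∧
    ∀ a : adjAlgebra D, (a : Matrix X X ℂ) * T = T * ρ a}
  zero_mem' := ⟨fun _ _ _ => rfl, fun a => by rw [Matrix.mul_zero, Matrix.zero_mul]⟩
  add_mem' := fun {S T} hS hT =>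
    ⟨fun y hy k => by rw [Matrix.add_apply, hS.1 y hy k, hT.1 y hy k, add_zero],
      fun a => by rw [Matrix.mul_add, Matrix.add_mul, hS.2 a, hT.2 a]⟩
  smul_mem' := fun z T hT =>
    ⟨fun y hy k => by rw [Matrix.smul_apply, hT.1 y hy k, smul_zero],
      fun a => by rw [Matrix.mul_smul, Matrix.smul_mul, hT.2 a]⟩

/-- The irreducible character `φ` of `ℂD` has multiplicity `m` in the standard character of the
sub-configuration on `xD`. -/
def HasMultiplicity (D : Set (Set (X × X))) (x : X) (φ : adjAlgebra D → ℂ) (m : ℕ) : Prop :=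
  ∃ (n : ℕ) (ρ : adjAlgebra D →ₐ[ℂ] Matrix (Fin n) (Fin n) ℂ),
    IsIrreducibleRep ρ ∧ Affords ρ φ ∧ Module.finrank ℂ (homToStandard D x ρ) = m

end Characters

section Construction

variable {X : Type u}

/-- An ordering of each member of `X/D` by `0, …, ℓ - 1` with respect to which all diagonal blocks
of the matrix `e` are one and the same matrix `block`. -/
structure Frame (D : Set (Set (X × X))) (e : Matrix X X ℂ) (ℓ : ℕ) where
  order : ∀ S : Cosets D, Fin ℓ ≃ S.1
  block : Matrix (Fin ℓ) (Fin ℓ) ℂ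
  block_eq : ∀ (S : Cosets D) (s t : Fin ℓ), e (order S s) (order S t) = block s t

/-- `(Γ(M))_{S,T}` is the scalar `a` such that the `(S, T)`-block of `M` is `a • block`. It is
meaningful for `M = e * M * e`, when `block` has rank one. -/
noncomputable def Frame.gamma {D : Set (Set (X × X))} {e : Matrix X X ℂ} {ℓ : ℕ}
    (F : Frame D e ℓ) (M : Matrix X X ℂ) : Matrix (Cosets D) (Cosets D) ℂ :=
  Matrix.of fun S T => Classical.epsilon fun a : ℂ =>
    ∀ s t, M (F.order S s) (F.order T t) = a * F.block s t

variable [Fintype X] [DecidableEq X]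

/-- `Γ` is well defined on `e M_X(ℂ) e` and it is a homomorphism of unital algebras from there to
the matrices over `X/D`. -/
structure Frame.GammaIsAlgHom {D : Set (Set (X × X))} {e : Matrix X X ℂ} {ℓ : ℕ}
    (F : Frame D e ℓ) : Prop where
  spec : ∀ M, e * M * e = M → ∀ S T, ∃! a : ℂ,
    ∀ s t, M (F.order S s) (F.order T t) = a * F.block s t
  map_one : F.gamma e = 1
  map_add : ∀ M N, e * M * e = M → e * N * e = N → F.gamma (M + N) = F.gamma M + F.gamma N
  map_smul : ∀ (z : ℂ) M, e * M * e = M → F.gamma (z • M) = z • F.gamma M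
  map_mul : ∀ M N, e * M * e = M → e * N * e = N → F.gamma (M * N) = F.gamma M * F.gamma N

/-- `(c_l)` is an admissible system of representatives in `C` for the classes of `C//D`: each class
is `c_l^D` for exactly one `l`, and `e A_{c_l} e ≠ 0` whenever the class of `c_l` has a
representative with this property. -/
structure IsRepresentatives (C D : Set (Set (X × X))) (e : Matrix X X ℂ)
    {L : Type*} (c : L → Set (X × X)) : Prop where
  mem : ∀ l, c l ∈ C
  surj : factor C D = Set.range fun l => factorRel D (c l)
  inj : Function.Injective fun l => factorRel D (c l)
  ne_zero : ∀ l, (∃ c' ∈ C, factorRel D c' = factorRel D (c l) ∧ e * adj c' * e ≠ 0) →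
    e * adj (c l) * e ≠ 0

end Construction

end CohConf

/-! The algebra `ℂC` consists of the matrices that are constant on the members of `C`
(`mem_span_adj_iff`). A matrix over `X/D` is constant on `C//D` exactly when its pullback to `X` is
constant on `C`, and pullback respects products up to the factor `|xD|`. This gives the factor
configuration.

`ℂD` is closed under adjoints, so the kernel of an irreducible representation `ρ` is cut off by a
Hermitian central idempotent `e` (`exists_idempotent`), which is the idempotent of `φ`. By
Burnside's theorem `ρ` is onto, and every row vector then yields a homomorphism into the standard
module. So the degree is at most the multiplicity (`IsIrreducibleRep.le_finrank`), and multiplicity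
one forces degree one.

The columns of `e` over the coset of `x₀` then lie in a one-dimensional space, so that diagonal
block has rank one. Coherence carries the absolute values of its entries to every coset, and a
Cauchy-Schwarz equality upgrades this to rank one everywhere (`exists_isRankOne`). Each block is
thus recovered from one of its columns. These columns have the same distribution of values in all
cosets, hence the common ordering.

For a choice `p` of representatives, `compress` and `inflate` are mutually inverse isomorphisms
between `e M_X(ℂ) e` and `M_{X/D}(ℂ)`, and `Γ` is `compress`. Inflation multiplies entries by
nonzero factors that depend only on the row and on the column. Hence matrices from `e ℂC e` are
proportional on each class of `C//D` (`IsRankOne.mul_eq_mul_of_factorRel`). One nonzero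
representative per class therefore suffices to span the image of `e ℂC e`, which is an algebra. -/

namespace CohConf

universe u

open scoped ComplexOrder

/-! ### Matrices and relations that are constant on the members of a partition -/

section Constant

variable {X : Type u}

/-- The matrix `M` is constant on each member of `C`. -/
def IsConst (C : Set (Set (X × X))) (M : Matrix X X ℂ) : Prop :=
  ∀ c ∈ C, ∀ x y x' y', (x, y) ∈ c → (x', y') ∈ c → M x y = M x' y'

/-- The relation `P` is a union of members of `C`, provided that `C` is a partition. -/
def RelConst (C : Set (Set (X × X))) (P : X → X → Prop) : Prop :=
  ∀ c ∈ C, ∀ x y x' y', (x, y) ∈ c → (x', y') ∈ c → P x y → P x' y'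

open Classical in
/-- The adjacency matrix of a binary relation. -/
noncomputable def ind (P : X → X → Prop) : Matrix X X ℂ :=
  Matrix.of fun x y => if P x y then 1 else 0

open Classical in
theorem adj_apply (c : Set (X × X)) (x y : X) : adj c x y = if (x, y) ∈ c then 1 else 0 := rfl

open Classical in
theorem ind_apply (P : X → X → Prop) (x y : X) : ind P x y = if P x y then 1 else 0 := rfl

theorem RelConst.isConst_ind {C : Set (Set (X × X))} {P : X → X → Prop} (h : RelConst C P) :
    IsConst C (ind P) := by
  intro c hc x y x' y' h1 h2
  have : P x y ↔ P x' y' := ⟨h c hc _ _ _ _ h1 h2, h c hc _ _ _ _ h2 h1⟩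
  by_cases hP : P x y
  · rw [ind_apply, ind_apply, if_pos hP, if_pos (this.1 hP)]
  · rw [ind_apply, ind_apply, if_neg hP, if_neg (mt this.2 hP)]

theorem eq_of_mem_of_mem {C : Set (Set (X × X))} (hC : Setoid.IsPartition C)
    {c c' : Set (X × X)} (hc : c ∈ C) (hc' : c' ∈ C) {p : X × X} (h : p ∈ c) (h' : p ∈ c') :
    c = c' :=
  (hC.2 p).unique ⟨hc, h⟩ ⟨hc', h'⟩

theorem relConst_mem {C : Set (Set (X × X))} (hC : Setoid.IsPartition C)
    {S : Set (Set (X × X))} (hS : S ⊆ C) : RelConst C (fun x y => ∃ s ∈ S, (x, y) ∈ s) := by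
  rintro c hc x y x' y' h1 h2 ⟨s, hs, h⟩
  exact ⟨s, hs, eq_of_mem_of_mem hC hc (hS hs) h1 h ▸ h2⟩

theorem relConst_member {C : Set (Set (X × X))} (hC : Setoid.IsPartition C)
    {c : Set (X × X)} (hc : c ∈ C) : RelConst C fun x y => (x, y) ∈ c := by
  simpa using relConst_mem hC (Set.singleton_subset_iff.2 hc)

theorem isConst_adj {C : Set (Set (X × X))} (hC : Setoid.IsPartition C)
    {c : Set (X × X)} (hc : c ∈ C) : IsConst C (adj c) :=
  (relConst_member hC hc).isConst_ind

theorem IsConst.add {C : Set (Set (X × X))} {M N : Matrix X X ℂ} (hM : IsConst C M)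
    (hN : IsConst C N) : IsConst C (M + N) := by
  intro c hc x y x' y' h1 h2
  simp [hM c hc _ _ _ _ h1 h2, hN c hc _ _ _ _ h1 h2]

theorem IsConst.smul {C : Set (Set (X × X))} {M : Matrix X X ℂ} (hM : IsConst C M)
    (z : ℂ) : IsConst C (z • M) := by
  intro c hc x y x' y' h1 h2
  simp [hM c hc _ _ _ _ h1 h2]

theorem isConst_zero (C : Set (Set (X × X))) : IsConst C 0 := by
  intro c hc x y x' y' h1 h2
  simp

theorem isConst_of_mem_span {C S : Set (Set (X × X))} (hC : Setoid.IsPartition C) (hS : S ⊆ C)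
    {M : Matrix X X ℂ} (hM : M ∈ Submodule.span ℂ (adj '' S)) : IsConst C M := by
  induction hM using Submodule.span_induction with
  | mem M h =>
    obtain ⟨c, hc, rfl⟩ := h
    exact isConst_adj hC (hS hc)
  | zero => exact isConst_zero C
  | add M N _ _ hM hN => exact hM.add hN
  | smul z M _ hM => exact hM.smul z

theorem apply_eq_zero_of_mem_span {S : Set (Set (X × X))} {M : Matrix X X ℂ}
    (hM : M ∈ Submodule.span ℂ (adj '' S)) {x y : X} (h : ¬ ∃ s ∈ S, (x, y) ∈ s) : M x y = 0 := by
  induction hM using Submodule.span_induction with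
  | mem M h' =>
    obtain ⟨c, hc, rfl⟩ := h'
    rw [adj_apply, if_neg fun h' => h ⟨c, hc, h'⟩]
  | zero => rfl
  | add M N _ _ hM hN => rw [Matrix.add_apply, hM, hN, add_zero]
  | smul z M _ hM => rw [Matrix.smul_apply, hM, smul_zero]

theorem mem_span_adj [Finite X] {C S : Set (Set (X × X))} (hC : Setoid.IsPartition C) (hS : S ⊆ C)
    {M : Matrix X X ℂ} (hM : IsConst C M)
    (h0 : ∀ x y, (¬ ∃ s ∈ S, (x, y) ∈ s) → M x y = 0) :
    M ∈ Submodule.span ℂ (adj '' S) := by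
  classical
  have hex : ∀ c : Set (X × X), ∃ z : ℂ, c ∈ S → ∀ x y, (x, y) ∈ c → M x y = z := by
    intro c
    by_cases hc : c ∈ S
    · obtain ⟨⟨x, y⟩, hp⟩ := Setoid.nonempty_of_mem_partition hC (hS hc)
      exact ⟨M x y, fun _ x' y' h => hM c (hS hc) _ _ _ _ h hp⟩
    · exact ⟨0, fun h => absurd h hc⟩
  choose z hz using hex
  have key : M = ∑ c ∈ S.toFinite.toFinset, z c • adj c := by
    ext x y
    rw [Matrix.sum_apply]
    by_cases h : ∃ s ∈ S, (x, y) ∈ s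
    · obtain ⟨s, hs, hxy⟩ := h
      rw [Finset.sum_eq_single s]
      · simp [adj_apply, hxy, hz s hs x y hxy]
      · intro c hc hne
        have : (x, y) ∉ c := fun h' => hne
          (eq_of_mem_of_mem hC (hS (by simpa using hc)) (hS hs) h' hxy)
        simp [adj_apply, this]
      · intro h'
        exact absurd (by simpa using hs) h'
    · rw [h0 x y h, Finset.sum_eq_zero]
      intro c hc
      have : (x, y) ∉ c := fun h' => h ⟨c, by simpa using hc, h'⟩
      simp [adj_apply, this]
  rw [key]
  exact Submodule.sum_mem _ fun c hc => Submodule.smul_mem _ _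
    (Submodule.subset_span ⟨c, by simpa using hc, rfl⟩)

/-- Membership in `ℂC` becomes a pointwise condition, so that coherence reads as closure of this
condition under products. -/
theorem mem_span_adj_iff [Finite X] {C : Set (Set (X × X))} (hC : Setoid.IsPartition C)
    {M : Matrix X X ℂ} : M ∈ Submodule.span ℂ (adj '' C) ↔ IsConst C M := by
  refine ⟨isConst_of_mem_span hC subset_rfl, fun h => mem_span_adj hC subset_rfl h ?_⟩
  intro x y hxy
  obtain ⟨c, hc, -⟩ := hC.2 (x, y)
  exact absurd ⟨c, hc⟩ hxy

open Classical in
theorem ind_mul_ind_apply [Fintype X] (P Q : X → X → Prop) (x y : X) :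
    (ind P * ind Q) x y = ((Finset.univ.filter fun z => P x z ∧ Q z y).card : ℂ) := by
  rw [Matrix.mul_apply, ← Finset.sum_boole]
  refine Finset.sum_congr rfl fun z _ => ?_
  by_cases h1 : P x z <;> by_cases h2 : Q z y <;> simp [ind_apply, h1, h2]

theorem ind_mul_ind_ne_zero [Fintype X] (P Q : X → X → Prop) (x y : X) :
    (ind P * ind Q) x y ≠ 0 ↔ ∃ z, P x z ∧ Q z y := by
  classical
  rw [ind_mul_ind_apply, Nat.cast_ne_zero, Finset.card_ne_zero]
  simp [Finset.Nonempty]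

/-- The member `xD` of `X/D`. -/
def cosetMk (D : Set (Set (X × X))) (x : X) : Cosets D := ⟨coset D x, x, rfl⟩

theorem cosetMk_surjective {D : Set (Set (X × X))} (S : Cosets D) : ∃ x, cosetMk D x = S := by
  obtain ⟨S, x, rfl⟩ := S
  exact ⟨x, rfl⟩

theorem transp_factorRel (D : Set (Set (X × X))) (c : Set (X × X)) :
    transp (factorRel D c) = factorRel D (transp c) := by
  ext ⟨S, T⟩
  constructor
  · rintro ⟨⟨x, y⟩, h, hx, hy⟩
    exact ⟨⟨y, x⟩, h, hy, hx⟩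
  · rintro ⟨⟨x, y⟩, h, hx, hy⟩
    exact ⟨⟨y, x⟩, h, hy, hx⟩

end Constant

/-! ### Consequences of coherence and homogeneity -/

section Configuration

variable {X : Type u} [Fintype X] [DecidableEq X] {C : Set (Set (X × X))}

theorem IsConst.mul (hC : IsCoherent C) {M N : Matrix X X ℂ} (hM : IsConst C M)
    (hN : IsConst C N) : IsConst C (M * N) := by
  obtain ⟨B, hB⟩ := hC.algebra
  simp only [← mem_span_adj_iff hC.partition, ← hB, Subalgebra.mem_toSubmodule] at *
  exact B.mul_mem hM hN

theorem IsConst.conjTranspose (hC : IsCoherent C) {M : Matrix X X ℂ} (hM : IsConst C M) :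
    IsConst C M.conjTranspose := by
  intro c hc x y x' y' h1 h2
  rw [Matrix.conjTranspose_apply, Matrix.conjTranspose_apply,
    hM _ (hC.transp_mem c hc) y x y' x' h1 h2]

theorem RelConst.swap (hC : IsCoherent C) {P : X → X → Prop} (hP : RelConst C P) :
    RelConst C fun x y => P y x := fun c hc x y x' y' h1 h2 h =>
  hP _ (hC.transp_mem c hc) y x y' x' h1 h2 h

/-- An entry of the product of two 0/1 matrices counts intermediate points, so it is nonzero exactly
when the composite relation holds. -/
theorem RelConst.comp (hC : IsCoherent C) {P Q : X → X → Prop} (hP : RelConst C P)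
    (hQ : RelConst C Q) : RelConst C fun x y => ∃ z, P x z ∧ Q z y := by
  intro c hc x y x' y' h1 h2 h
  rw [← ind_mul_ind_ne_zero] at h ⊢
  rwa [← hP.isConst_ind.mul hC hQ.isConst_ind c hc _ _ _ _ h1 h2]

theorem IsConst.diag_eq (hC : IsHomogeneous C) {M : Matrix X X ℂ} (hM : IsConst C M) (x y : X) :
    M x x = M y y :=
  hM _ hC.diagonal_mem _ _ _ _ rfl rfl

/-- The out-degree at `x` is the diagonal entry at `x` of `ind P` times its transpose, and
homogeneity makes diagonal entries equal. -/
theorem RelConst.ncard_eq (hC : IsHomogeneous C) {P : X → X → Prop} (hP : RelConst C P)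
    (x y : X) : {z | P x z}.ncard = {z | P y z}.ncard := by
  classical
  have h := (hP.isConst_ind.mul hC.toIsCoherent
    (hP.swap hC.toIsCoherent).isConst_ind).diag_eq hC x y
  rw [ind_mul_ind_apply, ind_mul_ind_apply, Nat.cast_inj] at h
  simpa [Set.ncard_eq_toFinset_card'] using h

theorem exists_mem_of_mem (hC : IsHomogeneous C) {c : Set (X × X)} (hc : c ∈ C) {x y : X}
    (h : (x, y) ∈ c) (x' : X) : ∃ y', (x', y') ∈ c := by
  have h1 := relConst_member hC.partition hc
  obtain ⟨z, hz, -⟩ := h1.comp hC.toIsCoherent (h1.swap hC.toIsCoherent) _ hC.diagonal_mem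
    x x x' x' rfl rfl ⟨y, h, h⟩
  exact ⟨z, hz⟩

/-- A matrix that is constant on the members of a homogeneous configuration vanishes if one of its
columns does. -/
theorem IsConst.eq_zero (hC : IsHomogeneous C) {M : Matrix X X ℂ} (hM : IsConst C M) (x : X)
    (h : ∀ y, M y x = 0) : M = 0 := by
  have h0 : (M.conjTranspose * M) x x = 0 := by simp [Matrix.mul_apply, h]
  have h1 := (hM.conjTranspose hC.toIsCoherent).mul hC.toIsCoherent hM
  rw [← Matrix.trace_conjTranspose_mul_self_eq_zero_iff]
  exact Finset.sum_eq_zero fun y _ => (h1.diag_eq hC y x).trans h0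

end Configuration

/-! ### Cosets of a closed subset and the factor configuration -/

section Closed

variable {X : Type u} [Fintype X] [DecidableEq X] {C D : Set (Set (X × X))}

theorem coe_adjAlgebra (hD : IsClosedSubset C D) :
    Subalgebra.toSubmodule (adjAlgebra D) = Submodule.span ℂ (adj '' D) := by
  obtain ⟨-, B, hB⟩ := hD
  refine le_antisymm ?_ (Algebra.span_le_adjoin ℂ _)
  rw [← hB]
  refine Algebra.adjoin_le (S := B) ?_
  intro M hM
  rw [SetLike.mem_coe, ← Subalgebra.mem_toSubmodule, hB]
  exact Submodule.subset_span hM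

theorem mem_adjAlgebra (hC : IsCoherent C) (hD : IsClosedSubset C D) {M : Matrix X X ℂ} :
    M ∈ adjAlgebra D ↔ IsConst C M ∧ ∀ x y, y ∉ coset D x → M x y = 0 := by
  rw [← Subalgebra.mem_toSubmodule, coe_adjAlgebra hD]
  exact ⟨fun h => ⟨isConst_of_mem_span hC.partition hD.1 h,
    fun x y => apply_eq_zero_of_mem_span h⟩, fun h => mem_span_adj hC.partition hD.1 h.1 h.2⟩

theorem relConst_coset (hC : IsCoherent C) (hD : IsClosedSubset C D) :
    RelConst C fun x y => y ∈ coset D x :=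
  relConst_mem hC.partition hD.1

theorem mem_coset_self (hC : IsCoherent C) (hD : IsClosedSubset C D) (x : X) : x ∈ coset D x := by
  by_contra h
  simpa using ((mem_adjAlgebra hC hD).1 (adjAlgebra D).one_mem).2 x x h

theorem mem_coset_trans (hC : IsCoherent C) (hD : IsClosedSubset C D) {x y z : X}
    (hy : y ∈ coset D x) (hz : z ∈ coset D y) : z ∈ coset D x := by
  have h : ind (fun x y => y ∈ coset D x) ∈ adjAlgebra D := (mem_adjAlgebra hC hD).2
    ⟨(relConst_coset hC hD).isConst_ind, fun x y h => if_neg h⟩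
  by_contra hxz
  exact (ind_mul_ind_ne_zero _ _ x z).2 ⟨y, hy, hz⟩
    (((mem_adjAlgebra hC hD).1 ((adjAlgebra D).mul_mem h h)).2 x z hxz)

/-- Closure of `D` under transposition is not assumed. Transitivity gives one inclusion, and equal
finite cardinalities give equality. -/
theorem coset_eq (hC : IsHomogeneous C) (hD : IsClosedSubset C D) {x y : X}
    (hy : y ∈ coset D x) : coset D y = coset D x :=
  Set.eq_of_subset_of_ncard_le (fun _ hz => mem_coset_trans hC.toIsCoherent hD hy hz)
    ((relConst_coset hC.toIsCoherent hD).ncard_eq hC x y).le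

theorem mem_coset_iff (hC : IsHomogeneous C) (hD : IsClosedSubset C D) {x y : X} :
    y ∈ coset D x ↔ cosetMk D y = cosetMk D x := by
  refine ⟨fun h => Subtype.ext (coset_eq hC hD h), fun h => ?_⟩
  rw [← show coset D y = coset D x from congrArg Subtype.val h]
  exact mem_coset_self hC.toIsCoherent hD y

theorem mem_cosets_iff (hC : IsHomogeneous C) (hD : IsClosedSubset C D) {x : X} {S : Cosets D} :
    x ∈ S.1 ↔ cosetMk D x = S := by
  obtain ⟨y, rfl⟩ := cosetMk_surjective S
  exact mem_coset_iff hC hD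

theorem mem_factorRel_iff (hC : IsHomogeneous C) (hD : IsClosedSubset C D) {c : Set (X × X)}
    {S T : Cosets D} :
    (S, T) ∈ factorRel D c ↔ ∃ x y, cosetMk D x = S ∧ cosetMk D y = T ∧ (x, y) ∈ c := by
  constructor
  · rintro ⟨⟨x, y⟩, h, hx, hy⟩
    exact ⟨x, y, (mem_cosets_iff hC hD).1 hx, (mem_cosets_iff hC hD).1 hy, h⟩
  · rintro ⟨x, y, hx, hy, h⟩
    exact ⟨⟨x, y⟩, h, (mem_cosets_iff hC hD).2 hx, (mem_cosets_iff hC hD).2 hy⟩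

/-- Pulled back to `X`, the relation `c^D` is the composite of coset membership, `c` and coset
membership. -/
theorem relConst_factorRel (hC : IsHomogeneous C) (hD : IsClosedSubset C D) {c : Set (X × X)}
    (hc : c ∈ C) : RelConst C fun x y => (cosetMk D x, cosetMk D y) ∈ factorRel D c := by
  have h1 := relConst_member hC.partition hc
  have h2 := relConst_coset hC.toIsCoherent hD
  have h3 := (h2.comp hC.toIsCoherent h1).comp hC.toIsCoherent h2
  convert h3 using 3 with x y
  rw [mem_factorRel_iff hC hD]
  simp only [mem_coset_iff hC hD]
  constructor
  · rintro ⟨a, b, ha, hb, h⟩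
    exact ⟨b, ⟨a, ha, h⟩, hb.symm⟩
  · rintro ⟨b, ⟨a, ha, h⟩, hb⟩
    exact ⟨a, b, ha, hb.symm, h⟩

theorem factorRel_subset (hC : IsHomogeneous C) (hD : IsClosedSubset C D) {c c' : Set (X × X)}
    (hc : c ∈ C) (hc' : c' ∈ C) {p : Cosets D × Cosets D} (h : p ∈ factorRel D c)
    (h' : p ∈ factorRel D c') : factorRel D c ⊆ factorRel D c' := by
  obtain ⟨S, T⟩ := p
  rintro ⟨S', T'⟩ hp
  obtain ⟨x, y, rfl, rfl, hxy⟩ := (mem_factorRel_iff hC hD).1 h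
  obtain ⟨x', y', rfl, rfl, hxy'⟩ := (mem_factorRel_iff hC hD).1 hp
  exact relConst_factorRel hC hD hc' c hc _ _ _ _ hxy hxy' h'

theorem factorRel_eq (hC : IsHomogeneous C) (hD : IsClosedSubset C D) {c c' : Set (X × X)}
    (hc : c ∈ C) (hc' : c' ∈ C) {p : Cosets D × Cosets D} (h : p ∈ factorRel D c)
    (h' : p ∈ factorRel D c') : factorRel D c = factorRel D c' :=
  (factorRel_subset hC hD hc hc' h h').antisymm (factorRel_subset hC hD hc' hc h' h)

theorem factorRel_diagonal (hC : IsHomogeneous C) (hD : IsClosedSubset C D) :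
    factorRel D (Set.diagonal X) = Set.diagonal (Cosets D) := by
  ext ⟨S, T⟩
  rw [mem_factorRel_iff hC hD]
  constructor
  · rintro ⟨x, y, rfl, rfl, h⟩
    exact congrArg (cosetMk D) h
  · rintro h
    obtain ⟨x, rfl⟩ := cosetMk_surjective S
    exact ⟨x, x, rfl, h, rfl⟩

theorem isPartition_factor (hC : IsHomogeneous C) (hD : IsClosedSubset C D) :
    Setoid.IsPartition (factor C D) := by
  constructor
  · rintro ⟨c, hc, h⟩
    obtain ⟨⟨x, y⟩, hp⟩ := Setoid.nonempty_of_mem_partition hC.partition hc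
    exact (h ▸ (mem_factorRel_iff hC hD).2 ⟨x, y, rfl, rfl, hp⟩ : (cosetMk D x, cosetMk D y) ∈ (∅ : Set _))
  · rintro ⟨S, T⟩
    obtain ⟨x, rfl⟩ := cosetMk_surjective S
    obtain ⟨y, rfl⟩ := cosetMk_surjective T
    obtain ⟨c, ⟨hc, hxy⟩, -⟩ := hC.partition.2 (x, y)
    have h := (mem_factorRel_iff hC hD).2 ⟨x, y, rfl, rfl, hxy⟩
    refine ⟨factorRel D c, ⟨⟨c, hc, rfl⟩, h⟩, ?_⟩
    rintro _ ⟨⟨c', hc', rfl⟩, h'⟩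
    exact factorRel_eq hC hD hc' hc h' h

theorem isConst_factor_iff (hC : IsHomogeneous C) (hD : IsClosedSubset C D)
    {N : Matrix (Cosets D) (Cosets D) ℂ} :
    IsConst (factor C D) N ↔ IsConst C (N.submatrix (cosetMk D) (cosetMk D)) := by
  constructor
  · intro h c hc x y x' y' h1 h2
    exact h _ ⟨c, hc, rfl⟩ _ _ _ _ ((mem_factorRel_iff hC hD).2 ⟨x, y, rfl, rfl, h1⟩)
      ((mem_factorRel_iff hC hD).2 ⟨x', y', rfl, rfl, h2⟩)
  · rintro h _ ⟨c, hc, rfl⟩ S T S' T' h1 h2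
    obtain ⟨x, y, rfl, rfl, hxy⟩ := (mem_factorRel_iff hC hD).1 h1
    obtain ⟨x', y', rfl, rfl, hxy'⟩ := (mem_factorRel_iff hC hD).1 h2
    exact h c hc _ _ _ _ hxy hxy'

theorem ncard_cosets_eq (hC : IsHomogeneous C) (hD : IsClosedSubset C D) (S : Cosets D) (x : X) :
    S.1.ncard = (coset D x).ncard := by
  obtain ⟨y, rfl⟩ := cosetMk_surjective S
  exact (relConst_coset hC.toIsCoherent hD).ncard_eq hC y x

theorem sum_comp_cosetMk (hC : IsHomogeneous C) (hD : IsClosedSubset C D) (x : X)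
    (f : Cosets D → ℂ) : ∑ y, f (cosetMk D y) = (coset D x).ncard * ∑ S, f S := by
  rw [← Finset.sum_fiberwise' Finset.univ (cosetMk D) f, Finset.mul_sum]
  refine Finset.sum_congr rfl fun S _ => ?_
  rw [Finset.sum_const, nsmul_eq_mul, ← ncard_cosets_eq hC hD S x, ← Set.ncard_coe_finset]
  congr 3
  ext y
  simp [mem_cosets_iff hC hD]

/-- The factor configuration of a homogeneous coherent configuration. -/
theorem isHomogeneous_factor (hC : IsHomogeneous C) (hD : IsClosedSubset C D) :
    IsHomogeneous (factor C D) where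
  partition := isPartition_factor hC hD
  transp_mem := by
    rintro _ ⟨c, hc, rfl⟩
    rw [transp_factorRel]
    exact ⟨_, hC.transp_mem c hc, rfl⟩
  diagonal := ⟨{Set.diagonal _}, Set.singleton_subset_iff.2
    ⟨_, hC.diagonal_mem, factorRel_diagonal hC hD⟩, Set.sUnion_singleton _⟩
  diagonal_mem := ⟨_, hC.diagonal_mem, factorRel_diagonal hC hD⟩
  algebra := by
    have key : ∀ M N : Matrix (Cosets D) (Cosets D) ℂ, IsConst (factor C D) M →
        IsConst (factor C D) N → IsConst (factor C D) (M * N) := by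
      intro M N hM hN
      rcases isEmpty_or_nonempty X with hX | ⟨⟨x⟩⟩
      · rintro _ _ S
        exact hX.elim (cosetMk_surjective S).choose
      · rw [isConst_factor_iff hC hD] at *
        have hne : ((coset D x).ncard : ℂ) ≠ 0 := by
          rw [Nat.cast_ne_zero, ← Nat.pos_iff_ne_zero, Set.ncard_pos]
          exact ⟨x, mem_coset_self hC.toIsCoherent hD x⟩
        -- All fibres of `X → X/D` have the same size, so the product of the pullbacks is `|xD|`
        -- times the pullback of the product.
        convert (hM.mul hC.toIsCoherent hN).smul ((coset D x).ncard : ℂ)⁻¹ using 1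
        ext y z
        rw [Matrix.smul_apply, smul_eq_mul, eq_inv_mul_iff_mul_eq₀ hne, Matrix.mul_apply,
          Matrix.submatrix_apply, Matrix.mul_apply, ← sum_comp_cosetMk hC hD x
            (fun S => M (cosetMk D y) S * N S (cosetMk D z))]
        rfl
    have hone : IsConst (factor C D) (1 : Matrix (Cosets D) (Cosets D) ℂ) := by
      have := isConst_adj (isPartition_factor hC hD)
        ⟨_, hC.diagonal_mem, factorRel_diagonal hC hD⟩
      convert this
      ext S T
      simp [adj_apply, Matrix.one_apply]
    refine ⟨(Submodule.span ℂ (adj '' factor C D)).toSubalgebra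
      ((mem_span_adj_iff (isPartition_factor hC hD)).2 hone) ?_,
      Submodule.toSubalgebra_toSubmodule _ _ _⟩
    intro M N
    simp only [mem_span_adj_iff (isPartition_factor hC hD)]
    exact key M N

end Closed

/-! ### Central idempotents of self-adjoint matrix algebras -/

section Idempotent

variable {X : Type u} [Fintype X]

/-- A matrix can be split along any linear subspace and its complement that is orthogonal for the
trace form. -/
theorem exists_add_of_submodule (K : Submodule ℂ (Matrix X X ℂ)) (M : Matrix X X ℂ) :
    ∃ f ∈ K, ∃ e, M = f + e ∧ ∀ k ∈ K, (k.conjTranspose * e).trace = 0 := by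
  -- Flattening a matrix to a Euclidean vector turns the trace form into the inner product.
  let ι : Matrix X X ℂ →ₗ[ℂ] EuclideanSpace ℂ (X × X) :=
    { toFun := fun M => WithLp.toLp 2 fun p => M p.1 p.2
      map_add' := fun _ _ => rfl
      map_smul' := fun _ _ => rfl }
  have hι : ∀ M x y, ι M (x, y) = M x y := fun _ _ _ => rfl
  obtain ⟨_, ⟨f, hf, rfl⟩, z, hz, h⟩ := (K.map ι).exists_add_mem_mem_orthogonal (ι M)
  refine ⟨f, hf, M - f, by abel, fun k hk => ?_⟩
  have hz' : z = ι (M - f) := by rw [map_sub, h]; abel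
  have := (Submodule.mem_orthogonal _ _).1 hz (ι k) ⟨k, hk, rfl⟩
  rw [hz', PiLp.inner_apply, Fintype.sum_prod_type_right] at this
  rw [← this, Matrix.trace]
  refine Finset.sum_congr rfl fun x _ => ?_
  rw [Matrix.diag_apply, Matrix.mul_apply]
  refine Finset.sum_congr rfl fun y _ => ?_
  rw [hι, hι, Matrix.conjTranspose_apply, RCLike.inner_apply, mul_comm]
  rfl

variable [DecidableEq X] {T : Type*} [Ring T] [Algebra ℂ T]

/-- The kernel of a homomorphism on a self-adjoint matrix algebra is complemented by the ideal that
is generated by a Hermitian central idempotent. -/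
theorem exists_idempotent (A : Subalgebra ℂ (Matrix X X ℂ))
    (hA : ∀ a ∈ A, a.conjTranspose ∈ A) (ρ : A →ₐ[ℂ] T) :
    ∃ e : A, e * e = e ∧ (∀ a, e * a = a * e) ∧ ρ e = 1 ∧ (∀ a, ρ a = 0 → a * e = 0) ∧
      (e : Matrix X X ℂ).conjTranspose = e := by
  obtain ⟨_, ⟨f, hf, rfl⟩, e', he', horth⟩ := exists_add_of_submodule
    ((LinearMap.ker ρ.toLinearMap).map A.val.toLinearMap) 1
  have hf0 : ρ f = 0 := hf
  obtain ⟨e, rfl⟩ : ∃ e : A, (e : Matrix X X ℂ) = e' :=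
    ⟨1 - f, by rw [AddSubgroupClass.coe_sub, OneMemClass.coe_one, he']; exact add_sub_cancel_left _ _⟩
  have hfe : f + e = 1 := Subtype.ext he'.symm
  have horth : ∀ k : A, ρ k = 0 → ((k : Matrix X X ℂ).conjTranspose * e).trace = 0 :=
    fun k hk => horth k ⟨k, hk, rfl⟩
  have hright : ∀ k : A, ρ k = 0 → k * e = 0 := by
    intro k hk
    -- The kernel is an ideal, so it contains `k* k e`; pairing this element with `e` gives the
    -- squared norm of `k e`.
    have h := horth (⟨_, hA k k.2⟩ * k * e) (by simp [hk])
    refine Subtype.ext (Matrix.trace_conjTranspose_mul_self_eq_zero_iff.1 ?_)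
    simpa [Matrix.conjTranspose_mul, Matrix.mul_assoc] using h
  have hleft : ∀ k : A, ρ k = 0 → e * k = 0 := by
    intro k hk
    have h := horth (e * k * ⟨_, hA k k.2⟩) (by simp [hk])
    refine Subtype.ext (Matrix.trace_conjTranspose_mul_self_eq_zero_iff.1 ?_)
    rw [MulMemClass.coe_mul, Matrix.conjTranspose_mul, ← Matrix.mul_assoc, Matrix.trace_mul_comm]
    simpa [Matrix.conjTranspose_mul, Matrix.mul_assoc] using h
  have hidem : e * e = e := by
    have := congrArg (· * e) hfe
    simpa [add_mul, hright f hf0] using this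
  have hρe : ρ e = 1 := by simpa [hf0] using congrArg ρ hfe
  have hcomm : ∀ a, e * a = a * e := by
    intro a
    have h1 : e * a = e * a * e := by
      have := congrArg (e * a * ·) hfe
      simpa [mul_add, mul_assoc, hleft (a * f) (by simp [hf0])] using this.symm
    have h2 : a * e = e * a * e := by
      have := congrArg (· * (a * e)) hfe
      simpa [add_mul, ← mul_assoc, hright (f * a) (by simp [hf0])] using this.symm
    rw [h1, h2]
  refine ⟨e, hidem, hcomm, hρe, hright, ?_⟩
  -- From `f f* e = 0` the squared norm of `f* e` vanishes. Then `e* = e* (f + e) = e* e`, which is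
  -- Hermitian.
  have hfe' : (e : Matrix X X ℂ).conjTranspose * f = 0 := by
    have h := congrArg Subtype.val (hright (f * ⟨_, hA f f.2⟩) (by simp [hf0]))
    rw [← Matrix.conjTranspose_eq_zero, ← Matrix.conjTranspose_mul_self_eq_zero]
    simp only [MulMemClass.coe_mul, ZeroMemClass.coe_zero] at h
    rw [Matrix.conjTranspose_conjTranspose, Matrix.conjTranspose_mul,
      Matrix.conjTranspose_conjTranspose, Matrix.mul_assoc, ← Matrix.mul_assoc (f : Matrix X X ℂ),
      h, Matrix.mul_zero]
  have h : (e : Matrix X X ℂ).conjTranspose = (e : Matrix X X ℂ).conjTranspose * e := by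
    have := congrArg ((e : Matrix X X ℂ).conjTranspose * ·) he'
    simpa [Matrix.mul_add, hfe'] using this
  have h' := congrArg Matrix.conjTranspose h
  rw [Matrix.conjTranspose_mul, Matrix.conjTranspose_conjTranspose] at h'
  rw [h, ← h']

end Idempotent

/-! ### Irreducible representations and their idempotents -/

section Irreducible

variable {R : Type u} [Ring R] [Algebra ℂ R] {n : ℕ} {ρ : R →ₐ[ℂ] Matrix (Fin n) (Fin n) ℂ}

theorem IsIrreducibleRep.eq_zero_or_one (hρ : IsIrreducibleRep ρ) {f : R} (hf : f * f = f)
    (hc : ∀ a, f * a = a * f) : ρ f = 0 ∨ ρ f = 1 := by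
  -- As `f` is central, the range of `ρ f` is an invariant subspace.
  have hinv : ∀ a, ∀ v ∈ LinearMap.range (ρ f).mulVecLin,
      (ρ a).mulVec v ∈ LinearMap.range (ρ f).mulVecLin := by
    rintro a _ ⟨w, rfl⟩
    exact ⟨(ρ a).mulVec w, by simp [Matrix.mulVec_mulVec, ← map_mul, hc]⟩
  rcases hρ.2 _ hinv with h | h
  · left
    rw [LinearMap.range_eq_bot] at h
    exact Matrix.toLin'.injective (by rw [Matrix.toLin'_apply', h, map_zero])
  · right
    refine Matrix.toLin'.injective (LinearMap.ext fun v => ?_)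
    obtain ⟨w, rfl⟩ := LinearMap.range_eq_top.1 h v
    simp [Matrix.mulVec_mulVec, ← map_mul, hf]

theorem IsIrreducibleRep.ne_zero_of_trace {φ : R → ℂ} (h : Affords ρ φ) {f : R}
    (hf : φ f ≠ 0) : ρ f ≠ 0 := fun h0 => hf (by rw [h, h0, Matrix.trace_zero])

theorem IsIrreducibleRep.isIdempotentOf_iff {φ : R → ℂ} (hρ : IsIrreducibleRep ρ)
    (h : Affords ρ φ) {e : R} (he : e * e = e) (hc : ∀ a, e * a = a * e) (h1 : ρ e = 1)
    (hk : ∀ a, ρ a = 0 → a * e = 0) (e' : R) : IsIdempotentOf φ e' ↔ e' = e := by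
  have hn : Nonempty (Fin n) := ⟨⟨0, Nat.pos_of_ne_zero hρ.1⟩⟩
  have hprim : ∀ f : R, f * f = f → (∀ a, f * a = a * f) → f * e = f → f = 0 ∨ f = e := by
    intro f hf hfc hfe
    rcases hρ.eq_zero_or_one hf hfc with h0 | h0
    · left
      rw [← hfe, hk f h0]
    · right
      have := hk (f - e) (by rw [map_sub, h0, h1, sub_self])
      rw [sub_mul, hfe, he, sub_eq_zero] at this
      exact this
  constructor
  · rintro ⟨h', hφ⟩
    have h0 := (hρ.eq_zero_or_one h'.idem h'.central).resolve_left
      (IsIrreducibleRep.ne_zero_of_trace h hφ)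
    -- The product `e * e'` is a nonzero central idempotent below both factors, so primitivity
    -- identifies it with each of them.
    have hne : ρ (e * e') ≠ 0 := by rw [map_mul, h0, h1, one_mul]; exact one_ne_zero
    have hidem : e * e' * (e * e') = e * e' := by
      rw [mul_assoc, ← mul_assoc e', ← hc e', mul_assoc e, h'.idem, ← mul_assoc, he]
    have hcentral : ∀ a, e * e' * a = a * (e * e') := by
      intro a
      rw [mul_assoc, h'.central, ← mul_assoc, hc, mul_assoc]
    have hne0 : e * e' ≠ 0 := fun h => hne (by rw [h, map_zero])
    have e1 := (h'.primitive _ hidem hcentral (by rw [mul_assoc, h'.idem])).resolve_left hne0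
    have e2 := (hprim _ hidem hcentral (by rw [mul_assoc, ← hc e', ← mul_assoc, he])).resolve_left
      hne0
    rw [← e1, e2]
  · rintro rfl
    refine ⟨⟨he, hc, ?_, hprim⟩, ?_⟩
    · rintro rfl
      rw [map_zero] at h1
      exact zero_ne_one h1
    · rw [h, h1, Matrix.trace_one, Fintype.card_fin, Nat.cast_ne_zero]
      exact hρ.1

/-- Burnside's theorem: an irreducible representation is onto. -/
theorem IsIrreducibleRep.surjective (hρ : IsIrreducibleRep ρ) : Function.Surjective ρ := by
  let V := Fin n → ℂ
  let τ : R →ₐ[ℂ] Module.End ℂ V := (Matrix.toLinAlgEquiv' : _ ≃ₐ[ℂ] Module.End ℂ V).toAlgHom.comp ρ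
  have hτ : ∀ a v, τ a v = (ρ a).mulVec v := fun a v => rfl
  let B := τ.range
  have hB : ∀ (b : B) (v : V), b • v = (b : Module.End ℂ V) v := fun _ _ => rfl
  have : Nontrivial V := by
    have : Nonempty (Fin n) := ⟨⟨0, Nat.pos_of_ne_zero hρ.1⟩⟩
    exact inferInstance
  have hsimple : IsSimpleModule B V := by
    refine (isSimpleModule_iff B V).2 ⟨fun U => ?_⟩
    rcases hρ.2 (U.restrictScalars ℂ) fun a v hv => U.smul_mem ⟨τ a, a, rfl⟩ hv with h | h
    · left
      simpa using h
    · right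
      simpa using h
  have hschur := IsSimpleModule.algebraMap_end_bijective_of_isAlgClosed (A := B) (V := V) ℂ
  intro N
  -- By Schur's lemma the endomorphisms of the simple module are scalars, so every matrix `N`
  -- commutes with them. Density then provides an element of `B` that agrees with `N` on the
  -- standard basis.
  let g : Module.End (Module.End B V) V :=
    { toFun := fun v => N.mulVec v
      map_add' := fun v w => N.mulVec_add v w
      map_smul' := fun f v => by
        obtain ⟨z, rfl⟩ := hschur.2 f
        exact N.mulVec_smul z v }
  obtain ⟨⟨_, a, rfl⟩, hb⟩ := jacobson_density (R := B) (M := V) g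
    (Finset.univ.image fun i : Fin n => Pi.single i (1 : ℂ))
  refine ⟨a, Matrix.ext fun i j => ?_⟩
  have h := congrFun (hb (Pi.single j 1) (by simp)) i
  have h' : N.mulVec (Pi.single j 1) i = (ρ a).mulVec (Pi.single j 1) i := h
  simpa using h'.symm

end Irreducible

/-! ### The degree is bounded by the multiplicity -/

section Multiplicity

variable {X : Type u} [Fintype X] [DecidableEq X] {C D : Set (Set (X × X))}

theorem conjTranspose_mem_adjAlgebra (hC : IsHomogeneous C) (hD : IsClosedSubset C D)
    {a : Matrix X X ℂ} (ha : a ∈ adjAlgebra D) : a.conjTranspose ∈ adjAlgebra D := by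
  rw [mem_adjAlgebra hC.toIsCoherent hD] at *
  refine ⟨ha.1.conjTranspose hC.toIsCoherent, fun x y h => ?_⟩
  rw [Matrix.conjTranspose_apply, ha.2 y x, star_zero]
  rwa [mem_coset_iff hC hD, eq_comm, ← mem_coset_iff hC hD]

/-- The degree of an irreducible representation is at most its multiplicity. -/
theorem IsIrreducibleRep.le_finrank (hC : IsHomogeneous C) (hD : IsClosedSubset C D) {n : ℕ}
    {ρ : adjAlgebra D →ₐ[ℂ] Matrix (Fin n) (Fin n) ℂ} (hρ : IsIrreducibleRep ρ) (x : X) :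
    n ≤ Module.finrank ℂ (homToStandard D x ρ) := by
  obtain ⟨e, he, hc, h1, hk, -⟩ := exists_idempotent (adjAlgebra D)
    (fun _ => conjTranspose_mem_adjAlgebra hC hD) ρ
  obtain ⟨s, hs⟩ := ρ.toLinearMap.exists_rightInverse_of_surjective
    (LinearMap.range_eq_top.2 hρ.surjective)
  have hs : ∀ N, ρ (s N) = N := fun N => LinearMap.congr_fun hs N
  -- Multiplying by `e` kills the kernel of `ρ`, so this linear section of `ρ` is compatible with
  -- left multiplication.
  let ψ : Matrix (Fin n) (Fin n) ℂ → adjAlgebra D := fun N => s N * e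
  have hψ : ∀ a N, a * ψ N = ψ (ρ a * N) := by
    intro a N
    have := hk (a * s N - s (ρ a * N)) (by simp [hs])
    rwa [sub_mul, sub_eq_zero, mul_assoc] at this
  have hψ' : ∀ N, ρ (ψ N) = N := fun N => by simp [ψ, hs, h1]
  have hadd : ∀ M N, ψ (M + N) = ψ M + ψ N := fun M N => by simp [ψ, add_mul]
  have hsmul : ∀ (z : ℂ) N, ψ (z • N) = z • ψ N := fun z N => by simp [ψ]
  let ψl : Matrix (Fin n) (Fin n) ℂ →ₗ[ℂ] adjAlgebra D :=
    { toFun := ψ, map_add' := hadd, map_smul' := hsmul }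
  -- The rank-one matrices with a fixed row vector `w` form a copy of the module of `ρ`. Lifting
  -- them by `ψ` and taking the column at `x` maps this copy into `ℂ(xD)`.
  let T : (Fin n → ℂ) → Matrix X (Fin n) ℂ := fun w => Matrix.of fun y k =>
    (ψ (Matrix.vecMulVec (Pi.single k 1) w) : Matrix X X ℂ) y x
  have hT : ∀ w, T w ∈ homToStandard D x ρ := by
    intro w
    refine ⟨fun y hy k => ?_, fun a => ?_⟩
    · refine ((mem_adjAlgebra hC.toIsCoherent hD).1 (ψ _).2).2 _ _ ?_
      rwa [mem_coset_iff hC hD, eq_comm, ← mem_coset_iff hC hD]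
    · ext y k
      have h2 := congrFun (congrFun (congrArg Subtype.val
        (hψ a (Matrix.vecMulVec (Pi.single k 1) w))) y) x
      rw [MulMemClass.coe_mul, Matrix.mul_apply] at h2
      rw [Matrix.mul_apply]
      refine h2.trans ?_
      have h3 : ρ a * Matrix.vecMulVec (Pi.single k 1) w =
          ∑ j, ρ a j k • Matrix.vecMulVec (Pi.single j 1) w := by
        ext i l
        simp [Matrix.sum_apply, Matrix.mul_apply, Matrix.vecMulVec_apply, Pi.single_apply]
      have h4 : ψ (ρ a * Matrix.vecMulVec (Pi.single k 1) w) =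
          ∑ j, ρ a j k • ψ (Matrix.vecMulVec (Pi.single j 1) w) := by
        rw [h3]
        exact (map_sum ψl _ _).trans (Finset.sum_congr rfl fun j _ => hsmul _ _)
      rw [h4, Matrix.mul_apply]
      simp [T, Matrix.sum_apply, mul_comm]
  let Φ : (Fin n → ℂ) →ₗ[ℂ] homToStandard D x ρ :=
    { toFun := fun w => ⟨T w, hT w⟩
      map_add' := fun v w => by
        ext y k
        simp [T, Matrix.vecMulVec_add, hadd]
      map_smul' := fun z w => by
        ext y k
        simp [T, Matrix.vecMulVec_smul, hsmul] }
  have hΦ : Function.Injective Φ := by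
    rw [injective_iff_map_eq_zero]
    intro w hw
    have hw' : T w = 0 := congrArg Subtype.val hw
    ext k
    -- Homogeneity gives injectivity: a matrix in `ℂC` with one zero column is zero.
    have h0 : ψ (Matrix.vecMulVec (Pi.single k 1) w) = 0 := by
      refine Subtype.ext (((mem_adjAlgebra hC.toIsCoherent hD).1 (Subtype.property _)).1.eq_zero
        hC x fun y => ?_)
      exact congrFun (congrFun hw' y) k
    have h5 := hψ' (Matrix.vecMulVec (Pi.single k 1) w)
    rw [h0, map_zero] at h5
    simpa [Matrix.vecMulVec_apply] using (congrFun (congrFun h5 k) k).symm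
  simpa using LinearMap.finrank_le_finrank_of_injective hΦ

end Multiplicity

/-! ### Rank-one diagonal blocks and the map `Γ` -/

section RankOne

variable {X : Type u} [Fintype X] {C D : Set (Set (X × X))}

/-- `E` is a Hermitian idempotent of `ℂD`, all diagonal blocks of which have rank one. The entries
on the diagonal are equal to `ε`. -/
structure IsRankOne (C D : Set (Set (X × X))) (E : Matrix X X ℂ) (ε : ℂ) : Prop where
  isConst : IsConst C E
  apply_eq_zero : ∀ x y, cosetMk D x ≠ cosetMk D y → E x y = 0
  conjTranspose_eq : E.conjTranspose = E
  idem : E * E = E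
  ne_zero : ε ≠ 0
  apply_self : ∀ x, E x x = ε
  mul_eq : ∀ x y z, cosetMk D x = cosetMk D y → cosetMk D y = cosetMk D z → E x y * E y z = ε * E x z

theorem IsRankOne.apply_ne_zero {E : Matrix X X ℂ} {ε : ℂ} (h : IsRankOne C D E ε) {x y : X}
    (hxy : cosetMk D x = cosetMk D y) : E x y ≠ 0 := by
  intro h0
  have := h.mul_eq x y x hxy hxy.symm
  rw [h0, zero_mul, h.apply_self] at this
  exact mul_ne_zero h.ne_zero h.ne_zero this.symm

theorem sum_ite_cosetMk [DecidableEq X] (hC : IsHomogeneous C) (hD : IsClosedSubset C D) (x : X) (z : ℂ) :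
    (∑ y, if cosetMk D y = cosetMk D x then z else 0) = (coset D x).ncard * z := by
  rw [sum_comp_cosetMk hC hD x fun S => if S = cosetMk D x then z else 0]
  simp

/-- The idempotent of a linear character of multiplicity one has diagonal blocks of rank one. -/
theorem exists_isRankOne [DecidableEq X] (hC : IsHomogeneous C) (hD : IsClosedSubset C D)
    {ρ : adjAlgebra D →ₐ[ℂ] Matrix (Fin 1) (Fin 1) ℂ} {e : adjAlgebra D} (he : e * e = e)
    (h1 : ρ e = 1) (hk : ∀ a, ρ a = 0 → a * e = 0)
    (hh : (e : Matrix X X ℂ).conjTranspose = e) (x₀ : X)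
    (hm : Module.finrank ℂ (homToStandard D x₀ ρ) = 1) :
    ∃ ε, IsRankOne C D (e : Matrix X X ℂ) ε := by
  -- In degree one, `a` minus its scalar value lies in the kernel of `ρ`, which `e` annihilates.
  have hae : ∀ a : adjAlgebra D, (a : Matrix X X ℂ) * e = ρ a 0 0 • (e : Matrix X X ℂ) := by
    intro a
    have h2 := hk (a - ρ a 0 0 • 1) (by
      ext i j
      rw [Subsingleton.elim i 0, Subsingleton.elim j 0]
      simp)
    rw [sub_mul, sub_eq_zero, smul_mul_assoc, one_mul] at h2
    exact congrArg Subtype.val h2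
  have hidem : (e : Matrix X X ℂ) * e = e := congrArg Subtype.val he
  obtain ⟨hconst, hsupp⟩ := (mem_adjAlgebra hC.toIsCoherent hD).1 e.2
  have he0 : (e : Matrix X X ℂ) ≠ 0 := by
    intro h0
    rw [show e = 0 from Subtype.ext h0, map_zero] at h1
    exact zero_ne_one h1
  generalize (e : Matrix X X ℂ) = E at *
  have hsupp : ∀ x y, cosetMk D x ≠ cosetMk D y → E x y = 0 := fun x y h =>
    hsupp x y fun h' => h ((mem_coset_iff hC hD).1 h').symm
  have hstar : ∀ x y, star (E x y) = E y x := fun x y => by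
    rw [← Matrix.conjTranspose_apply, hh]
  have hdiag : ∀ x, E x x = E x₀ x₀ := fun x => hconst.diag_eq hC x x₀
  have hmulapp : ∀ x z, ∑ y, E x y * E y z = E x z := fun x z => by
    rw [← Matrix.mul_apply, hidem]
  have hε : E x₀ x₀ ≠ 0 := by
    intro h0
    refine he0 (Matrix.trace_conjTranspose_mul_self_eq_zero_iff.1 ?_)
    rw [hh, hidem]
    exact Finset.sum_eq_zero fun y _ => (hdiag y).trans h0
  -- Each column of `E` over the coset of `x₀` is a homomorphism into `ℂ(x₀D)`, and these form a
  -- line by multiplicity one.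
  have hcol : ∃ v : X → ℂ, ∀ t, cosetMk D t = cosetMk D x₀ → ∃ z : ℂ, ∀ s, E s t = z * v s := by
    obtain ⟨v, -, hv⟩ := finrank_eq_one_iff'.1 hm
    refine ⟨fun s => v.1 s 0, fun t ht => ?_⟩
    have hmem : (Matrix.of fun s (_ : Fin 1) => E s t) ∈ homToStandard D x₀ ρ := by
      refine ⟨fun y hy _ => hsupp y t fun h => hy ?_, fun a => ?_⟩
      · rw [mem_coset_iff hC hD, h, ht]
      · ext y k
        have := congrFun (congrFun (hae a) y) t
        rw [Matrix.mul_apply, Matrix.smul_apply] at this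
        rw [Subsingleton.elim k 0, Matrix.mul_apply, Matrix.mul_apply]
        simpa [mul_comm] using this
    obtain ⟨z, hz⟩ := hv ⟨_, hmem⟩
    exact ⟨z, fun s => (congrFun (congrFun (congrArg Subtype.val hz) s) 0).symm⟩
  have hbase : ∀ t, cosetMk D t = cosetMk D x₀ → E x₀ t * E t x₀ = E x₀ x₀ * E x₀ x₀ := by
    obtain ⟨v, hv⟩ := hcol
    intro t ht
    obtain ⟨z, hz⟩ := hv t ht
    obtain ⟨w, hw⟩ := hv x₀ rfl
    have h2 : E x₀ t * E t x₀ = E x₀ x₀ * E t t := by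
      rw [hz x₀, hz t, hw x₀, hw t]
      ring
    rw [h2, hdiag t]
  -- The member of `C` that contains `(x, y)` also contains a pair starting at `x₀`, so the absolute
  -- value of `E x y` already occurs in the block of `x₀`.
  have hnorm : ∀ x y, cosetMk D x = cosetMk D y → E x y * E y x = E x₀ x₀ * E x₀ x₀ := by
    intro x y hxy
    obtain ⟨c, ⟨hc, hp⟩, -⟩ := hC.partition.2 (x, y)
    obtain ⟨t, ht⟩ := exists_mem_of_mem hC hc hp x₀
    have htx : t ∈ coset D x₀ := relConst_coset hC.toIsCoherent hD c hc _ _ _ _ hp ht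
      ((mem_coset_iff hC hD).2 hxy.symm)
    rw [← hstar x y, hconst c hc _ _ _ _ hp ht, hstar]
    exact hbase t ((mem_coset_iff hC hD).1 htx)
  generalize E x₀ x₀ = ε at *
  have hεstar : star ε = ε := by rw [← hdiag x₀, hstar]
  have hcard : ∀ x, (coset D x).ncard * ε = 1 := by
    intro x
    have h2 : ∑ y, E x y * E y x = ∑ y, if cosetMk D y = cosetMk D x then ε * ε else 0 := by
      refine Finset.sum_congr rfl fun y _ => ?_
      split_ifs with h
      · exact hnorm x y h.symm
      · rw [hsupp y x h, mul_zero]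
    rw [hmulapp, hdiag, sum_ite_cosetMk hC hD] at h2
    refine mul_right_cancel₀ hε ?_
    rw [one_mul, mul_assoc, ← h2]
  refine ⟨ε, hconst, hsupp, hh, hidem, hε, hdiag, ?_⟩
  intro x y z hxy hyz
  -- The defect of the rank-one identity, as a vector in `y`. With all absolute values equal to `ε`
  -- and `|xD| ε = 1`, its squared norm is `2 ε⁴ |xD| - 2 ε³ = 0`; the cross terms are summed by `E²
  -- = E`.
  let t : X → ℂ := fun y => if cosetMk D y = cosetMk D x then E x y * E y z - ε * E x z else 0
  have ht : ∀ y, star (t y) * t y = (if cosetMk D y = cosetMk D x then 2 * ε ^ 4 else 0) -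
      ε * E z x * (E x y * E y z) - ε * E x z * (E z y * E y x) := by
    intro y
    by_cases h : cosetMk D y = cosetMk D x
    · have e1 := hnorm x y h.symm
      have e2 := hnorm y z (h.trans (hxy.trans hyz))
      have e3 := hnorm x z (hxy.trans hyz)
      simp only [t, if_pos h, star_sub, star_mul', hstar, hεstar]
      linear_combination (E y z * E z y) * e1 + ε * ε * e2 + ε * ε * e3
    · simp [t, if_neg h, hsupp y x h, hsupp x y (Ne.symm h)]
  have hsum : star t ⬝ᵥ t = 0 := by
    have h3 : star t ⬝ᵥ t = ∑ y, star (t y) * t y := rfl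
    rw [h3, Finset.sum_congr rfl fun y _ => ht y, Finset.sum_sub_distrib, Finset.sum_sub_distrib,
      ← Finset.mul_sum, ← Finset.mul_sum, hmulapp, hmulapp, sum_ite_cosetMk hC hD]
    linear_combination 2 * ε ^ 3 * hcard x - 2 * ε * hnorm x z (hxy.trans hyz)
  have := congrFun (dotProduct_star_self_eq_zero.1 hsum) y
  simp only [t, if_pos hxy.symm, Pi.zero_apply] at this
  exact sub_eq_zero.1 this

/-- The members of `X/D` can be ordered in such a way that all diagonal blocks are equal. -/
theorem IsRankOne.exists_frame [DecidableEq X] (hC : IsHomogeneous C) (hD : IsClosedSubset C D)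
    {E : Matrix X X ℂ} {ε : ℂ} (h : IsRankOne C D E ε) (x₀ : X) :
    ∃ ℓ, Nonempty (Frame D E ℓ) := by
  choose p hp using cosetMk_surjective (D := D)
  -- The number of entries equal to `z` in a column of a diagonal block does not depend on the
  -- column. Hence the chosen columns of any two cosets can be matched by a bijection.
  have hrel : ∀ z, RelConst C fun x y => cosetMk D y = cosetMk D x ∧ E y x = z := by
    rintro z c hc x y x' y' h1 h2 ⟨h3, h4⟩
    rw [← mem_coset_iff hC hD] at h3 ⊢
    exact ⟨relConst_coset hC.toIsCoherent hD c hc _ _ _ _ h1 h2 h3,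
      by rw [← h4, h.isConst _ (hC.transp_mem c hc) y x y' x' h1 h2]⟩
  have hcard : ∀ (S : Cosets D) (z : ℂ), Nat.card {a : S.1 // E a (p S) = z} =
      {y | cosetMk D y = cosetMk D (p S) ∧ E y (p S) = z}.ncard := by
    intro S z
    refine Nat.card_congr
      { toFun := fun a => ⟨a.1.1, (mem_cosets_iff hC hD).1 a.1.2 |>.trans (hp S).symm, a.2⟩
        invFun := fun b => ⟨⟨b.1, (mem_cosets_iff hC hD).2 (b.2.1.trans (hp S))⟩, b.2.2⟩
        left_inv := fun _ => rfl
        right_inv := fun _ => rfl }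
  let S₀ := cosetMk D x₀
  have hequiv : ∀ S : Cosets D, ∃ g : S₀.1 ≃ S.1, ∀ a, E (g a) (p S) = E a (p S₀) := by
    intro S
    have : ∀ z, Nonempty ({a : S₀.1 // E a (p S₀) = z} ≃ {a : S.1 // E a (p S) = z}) := by
      intro z
      refine Finite.card_eq.1 ?_
      rw [hcard, hcard]
      exact (hrel z).ncard_eq hC _ _
    exact ⟨Equiv.ofFiberEquiv fun z => (this z).some, fun a =>
      Equiv.ofFiberEquiv_map (fun z => (this z).some) a⟩
  choose g hg using hequiv
  -- Rank one and the Hermitian property recover the whole block from its column at `p S`, so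
  -- matching columns suffices.
  have key : ∀ (S : Cosets D) (x y : X), x ∈ S.1 → y ∈ S.1 →
      ε * E x y = E x (p S) * star (E y (p S)) := by
    intro S x y hx hy
    rw [mem_cosets_iff hC hD] at hx hy
    rw [← Matrix.conjTranspose_apply, h.conjTranspose_eq,
      h.mul_eq x (p S) y (hx.trans (hp S).symm) ((hp S).trans hy.symm)]
  refine ⟨_, ⟨⟨fun S => (Finite.equivFin S₀.1).symm.trans (g S),
    Matrix.of fun s t => E ((Finite.equivFin S₀.1).symm s) ((Finite.equivFin S₀.1).symm t), ?_⟩⟩⟩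
  intro S s t
  refine mul_left_cancel₀ h.ne_zero ?_
  rw [key S _ _ (Subtype.property _) (Subtype.property _), Matrix.of_apply,
    key S₀ _ _ (Subtype.property _) (Subtype.property _)]
  rw [← hg S, ← hg S]
  rfl

section Compression

variable (E : Matrix X X ℂ) (ε : ℂ) (p : Cosets D → X)

/-- The compression `e M_X(ℂ) e → M_{X/D}(ℂ)` with respect to a system of representatives. -/
noncomputable def compress (M : Matrix X X ℂ) : Matrix (Cosets D) (Cosets D) ℂ :=
  ε⁻¹ • (E.submatrix p id * M * E.submatrix id p)

/-- The inverse of the compression. -/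
noncomputable def inflate (N : Matrix (Cosets D) (Cosets D) ℂ) : Matrix X X ℂ :=
  ε⁻¹ • (E.submatrix id p * N * E.submatrix p id)

variable {E ε p} (h : IsRankOne C D E ε) (hp : ∀ S, cosetMk D (p S) = S)
include h

theorem IsRankOne.submatrix_mul_self : E.submatrix p id * E = E.submatrix p id := by
  ext S y
  exact congrFun (congrFun h.idem (p S)) y

theorem IsRankOne.mul_submatrix_self : E * E.submatrix id p = E.submatrix id p := by
  ext x S
  exact congrFun (congrFun h.idem x) (p S)

theorem IsRankOne.compress_mul_mul (M : Matrix X X ℂ) :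
    compress E ε p (E * M * E) = compress E ε p M := by
  rw [compress, compress, Matrix.mul_assoc, Matrix.mul_assoc (E * M), h.mul_submatrix_self,
    ← Matrix.mul_assoc, ← Matrix.mul_assoc, h.submatrix_mul_self]

include hp

theorem IsRankOne.submatrix_mul_submatrix :
    E.submatrix p id * E.submatrix id p = ε • (1 : Matrix (Cosets D) (Cosets D) ℂ) := by
  ext S T
  refine (congrFun (congrFun h.idem (p S)) (p T)).trans ?_
  rw [Matrix.smul_apply, Matrix.one_apply]
  split_ifs with hST
  · rw [hST, h.apply_self, smul_eq_mul, mul_one]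
  · rw [smul_zero, h.apply_eq_zero]
    rwa [hp, hp]

/-- This is the rank-one identity in matrix form. Together with `IsRankOne.submatrix_mul_submatrix`
it makes `compress` and `inflate` inverse to each other on `e M_X(ℂ) e`. -/
theorem IsRankOne.submatrix_mul_submatrix' :
    E.submatrix id p * E.submatrix p id = ε • E := by
  ext x y
  rw [Matrix.mul_apply, Finset.sum_eq_single (cosetMk D x)]
  · simp only [Matrix.submatrix_apply, id, Matrix.smul_apply, smul_eq_mul]
    by_cases hxy : cosetMk D x = cosetMk D y
    · exact h.mul_eq _ _ _ (hp _).symm ((hp _).trans hxy)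
    · rw [h.apply_eq_zero x y hxy, h.apply_eq_zero (p (cosetMk D x)) y (by rwa [hp]), mul_zero, mul_zero]
  · intro S _ hS
    rw [Matrix.submatrix_apply, id, h.apply_eq_zero x (p S) (by rw [hp]; exact hS.symm), zero_mul]
  · exact fun h => absurd (Finset.mem_univ _) h

theorem IsRankOne.inflate_compress (M : Matrix X X ℂ) :
    inflate E ε p (compress E ε p M) = E * M * E := by
  have h1 := h.submatrix_mul_submatrix' hp
  have : inflate E ε p (compress E ε p M) = ε⁻¹ • ε⁻¹ • ((E.submatrix id p * E.submatrix p id) *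
      M * (E.submatrix id p * E.submatrix p id)) := by
    simp only [inflate, compress, Matrix.mul_smul, Matrix.smul_mul, Matrix.mul_assoc]
  rw [this, h1]
  simp [h.ne_zero]

theorem IsRankOne.compress_inflate (N : Matrix (Cosets D) (Cosets D) ℂ) :
    compress E ε p (inflate E ε p N) = N := by
  have h1 := h.submatrix_mul_submatrix hp
  have : compress E ε p (inflate E ε p N) = ε⁻¹ • ε⁻¹ • ((E.submatrix p id * E.submatrix id p) *
      N * (E.submatrix p id * E.submatrix id p)) := by
    simp only [inflate, compress, Matrix.mul_smul, Matrix.smul_mul, Matrix.mul_assoc]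
  rw [this, h1]
  simp [h.ne_zero]

theorem IsRankOne.inflate_mul (M N : Matrix (Cosets D) (Cosets D) ℂ) :
    inflate E ε p (M * N) = inflate E ε p M * inflate E ε p N := by
  have h1 := h.submatrix_mul_submatrix hp
  have : inflate E ε p M * inflate E ε p N = ε⁻¹ • ε⁻¹ • (E.submatrix id p * (M *
      ((E.submatrix p id * E.submatrix id p) * N)) * E.submatrix p id) := by
    simp only [inflate, Matrix.mul_smul, Matrix.smul_mul, Matrix.mul_assoc]
  rw [this, h1]
  simp [inflate, h.ne_zero]

theorem IsRankOne.inflate_one : inflate E ε p 1 = E := by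
  rw [inflate, Matrix.mul_one, h.submatrix_mul_submatrix' hp, smul_smul, inv_mul_cancel₀ h.ne_zero,
    one_smul]

theorem IsRankOne.compress_mul {M N : Matrix X X ℂ} (hM : E * M * E = M) (hN : E * N * E = N) :
    compress E ε p (M * N) = compress E ε p M * compress E ε p N := by
  rw [← h.compress_inflate hp (compress E ε p M * _), h.inflate_mul hp, h.inflate_compress hp,
    h.inflate_compress hp, hM, hN]

/-- `E` is block diagonal, so a single term survives in each sum. The factors from `E` are nonzero,
which makes the zero pattern of `N` visible upstairs. -/
theorem IsRankOne.inflate_apply (N : Matrix (Cosets D) (Cosets D) ℂ) (x y : X) :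
    inflate E ε p N x y =
      ε⁻¹ * (E x (p (cosetMk D x)) * N (cosetMk D x) (cosetMk D y) * E (p (cosetMk D y)) y) := by
  rw [inflate, Matrix.smul_apply, smul_eq_mul, Matrix.mul_apply, Finset.sum_eq_single (cosetMk D y),
    Matrix.mul_apply, Finset.sum_eq_single (cosetMk D x)]
  · rfl
  · intro S _ hS
    rw [Matrix.submatrix_apply, id, h.apply_eq_zero x (p S) (by rw [hp]; exact hS.symm), zero_mul]
  · exact fun h => absurd (Finset.mem_univ _) h
  · intro S _ hS
    rw [Matrix.submatrix_apply, id, h.apply_eq_zero (p S) y (by rwa [hp]), mul_zero]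
  · exact fun h => absurd (Finset.mem_univ _) h

theorem IsRankOne.inflate_apply_eq_zero_iff (N : Matrix (Cosets D) (Cosets D) ℂ) (x y : X) :
    inflate E ε p N x y = 0 ↔ N (cosetMk D x) (cosetMk D y) = 0 := by
  rw [h.inflate_apply hp]
  simp [h.ne_zero, h.apply_ne_zero (hp (cosetMk D x)).symm, h.apply_ne_zero (hp (cosetMk D y))]

end Compression

theorem compress_add (E : Matrix X X ℂ) (ε : ℂ) (p : Cosets D → X) (M N : Matrix X X ℂ) :
    compress E ε p (M + N) = compress E ε p M + compress E ε p N := by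
  simp [compress, Matrix.mul_add, Matrix.add_mul]

theorem compress_smul (E : Matrix X X ℂ) (ε : ℂ) (p : Cosets D → X) (z : ℂ) (M : Matrix X X ℂ) :
    compress E ε p (z • M) = z • compress E ε p M := by
  simp [compress, smul_comm z]

theorem inflate_add (E : Matrix X X ℂ) (ε : ℂ) (p : Cosets D → X)
    (M N : Matrix (Cosets D) (Cosets D) ℂ) :
    inflate E ε p (M + N) = inflate E ε p M + inflate E ε p N := by
  simp [inflate, Matrix.mul_add, Matrix.add_mul]

theorem inflate_smul (E : Matrix X X ℂ) (ε : ℂ) (p : Cosets D → X) (z : ℂ)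
    (N : Matrix (Cosets D) (Cosets D) ℂ) :
    inflate E ε p (z • N) = z • inflate E ε p N := by
  simp [inflate, smul_comm z]

section Frame

variable [DecidableEq X] {E : Matrix X X ℂ} {ε : ℂ} {ℓ : ℕ}

theorem Frame.cosetMk_order (hC : IsHomogeneous C) (hD : IsClosedSubset C D) (F : Frame D E ℓ)
    (S : Cosets D) (s : Fin ℓ) : cosetMk D (F.order S s : X) = S :=
  (mem_cosets_iff hC hD).1 (F.order S s).2

/-- Taking the point at position `i` of every coset as its representative turns the factors from `E`
into entries of the common block, and rank one merges them into a single entry. -/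
theorem Frame.apply_order (hC : IsHomogeneous C) (hD : IsClosedSubset C D) (F : Frame D E ℓ)
    (h : IsRankOne C D E ε) (i : Fin ℓ) {M : Matrix X X ℂ} (hM : E * M * E = M) (S T : Cosets D)
    (s t : Fin ℓ) : M (F.order S s) (F.order T t) =
      compress E ε (fun S => (F.order S i : X)) M S T * F.block s t := by
  have hp := fun S => F.cosetMk_order hC hD S i
  have h1 := congrFun (congrFun (h.inflate_compress hp M) (F.order S s)) (F.order T t)
  have hb : F.block s i * F.block i t = ε * F.block s t := by
    rw [← F.block_eq S, ← F.block_eq S, ← F.block_eq S]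
    exact h.mul_eq _ _ _ (by simp only [F.cosetMk_order hC hD]) (by simp only [F.cosetMk_order hC hD])
  rw [hM, h.inflate_apply hp, F.cosetMk_order hC hD, F.cosetMk_order hC hD, F.block_eq, F.block_eq] at h1
  rw [← h1, mul_right_comm, hb, ← mul_assoc, ← mul_assoc, inv_mul_cancel₀ h.ne_zero, one_mul,
    mul_comm]

theorem Frame.existsUnique (hC : IsHomogeneous C) (hD : IsClosedSubset C D) (F : Frame D E ℓ)
    (h : IsRankOne C D E ε) (i : Fin ℓ) {M : Matrix X X ℂ} (hM : E * M * E = M)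
    (S T : Cosets D) : ∃! a : ℂ, ∀ s t, M (F.order S s) (F.order T t) = a * F.block s t := by
  refine ⟨_, F.apply_order hC hD h i hM S T, fun a ha => ?_⟩
  have hne : F.block i i ≠ 0 := by
    rw [← F.block_eq S, h.apply_self]
    exact h.ne_zero
  exact mul_right_cancel₀ hne ((ha i i).symm.trans (F.apply_order hC hD h i hM S T i i))

theorem Frame.gamma_eq (hC : IsHomogeneous C) (hD : IsClosedSubset C D) (F : Frame D E ℓ)
    (h : IsRankOne C D E ε) (i : Fin ℓ) {M : Matrix X X ℂ} (hM : E * M * E = M) :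
    F.gamma M = compress E ε (fun S => (F.order S i : X)) M := by
  ext S T
  have hex := F.existsUnique hC hD h i hM S T
  exact hex.unique (Classical.epsilon_spec hex.exists) (F.apply_order hC hD h i hM S T)

theorem Frame.gammaIsAlgHom (hC : IsHomogeneous C) (hD : IsClosedSubset C D) (F : Frame D E ℓ)
    (h : IsRankOne C D E ε) (i : Fin ℓ) : F.GammaIsAlgHom := by
  have hp := fun S => F.cosetMk_order hC hD S i
  have hg : ∀ M, E * M * E = M → F.gamma M = compress E ε (fun S => (F.order S i : X)) M :=
    fun _ => F.gamma_eq hC hD h i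
  refine ⟨fun M hM => F.existsUnique hC hD h i hM, ?_, fun M N hM hN => ?_, fun z M hM => ?_,
    fun M N hM hN => ?_⟩
  · rw [hg E (by rw [h.idem, h.idem]), ← h.compress_inflate hp 1, h.inflate_one hp]
  · rw [hg _ hM, hg _ hN, hg _ (by rw [Matrix.mul_add, Matrix.add_mul, hM, hN]), compress_add]
  · rw [hg _ hM, hg _ (by rw [Matrix.mul_smul, Matrix.smul_mul, hM]), compress_smul]
  · have h1 : E * M = M := by rw [← hM, ← Matrix.mul_assoc, ← Matrix.mul_assoc, h.idem]
    have h2 : N * E = N := by rw [← hN, Matrix.mul_assoc, h.idem]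
    rw [hg _ hM, hg _ hN, hg _ (by rw [← Matrix.mul_assoc, h1, Matrix.mul_assoc, h2]),
      h.compress_mul hp hM hN]

end Frame

end RankOne

/-! ### The weight on the factor configuration -/

section FactorWeight

theorem adj_transp {X : Type u} (c : Set (X × X)) : adj (transp c) = (adj c).conjTranspose := by
  ext x y
  rw [Matrix.conjTranspose_apply, adj_apply, adj_apply]
  by_cases hc : (y, x) ∈ c
  · rw [if_pos hc, if_pos (show (x, y) ∈ transp c from hc), star_one]
  · rw [if_neg hc, if_neg (show (x, y) ∉ transp c from hc), star_zero]

variable {X : Type u} [Fintype X] {C D : Set (Set (X × X))}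
  {E : Matrix X X ℂ} {ε : ℂ} {p : Cosets D → X}

theorem IsRankOne.compress_eq_zero_iff (h : IsRankOne C D E ε) (hp : ∀ S, cosetMk D (p S) = S)
    (M : Matrix X X ℂ) : compress E ε p M = 0 ↔ E * M * E = 0 := by
  constructor
  · intro h0
    rw [← h.inflate_compress hp, h0]
    simp [inflate]
  · intro h0
    rw [← h.compress_mul_mul, h0]
    simp [compress]

variable [DecidableEq X]

/-- Two matrices over `X/D` that come from `ℂC` are proportional on each member of `C//D`. -/
theorem IsRankOne.mul_eq_mul_of_factorRel (hC : IsHomogeneous C) (hD : IsClosedSubset C D)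
    (h : IsRankOne C D E ε) (hp : ∀ S, cosetMk D (p S) = S)
    {M N : Matrix (Cosets D) (Cosets D) ℂ} (hM : IsConst C (inflate E ε p M))
    (hN : IsConst C (inflate E ε p N)) {c : Set (X × X)} (hc : c ∈ C) {S T S' T' : Cosets D}
    (h1 : (S, T) ∈ factorRel D c) (h2 : (S', T') ∈ factorRel D c) :
    M S T * N S' T' = M S' T' * N S T := by
  obtain ⟨x, y, rfl, rfl, hxy⟩ := (mem_factorRel_iff hC hD).1 h1
  obtain ⟨x', y', rfl, rfl, hxy'⟩ := (mem_factorRel_iff hC hD).1 h2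
  have e1 := hM c hc _ _ _ _ hxy hxy'
  have e2 := hN c hc _ _ _ _ hxy hxy'
  rw [h.inflate_apply hp, h.inflate_apply hp] at e1 e2
  have a1 := h.apply_ne_zero (hp (cosetMk D x)).symm
  have a2 := h.apply_ne_zero (hp (cosetMk D y))
  have a3 := h.apply_ne_zero (hp (cosetMk D x')).symm
  have a4 := h.apply_ne_zero (hp (cosetMk D y'))
  generalize E x (p (cosetMk D x)) = b1 at *
  generalize E (p (cosetMk D y)) y = b2 at *
  generalize E x' (p (cosetMk D x')) = b3 at *
  generalize E (p (cosetMk D y')) y' = b4 at *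
  have e1 := mul_left_cancel₀ (inv_ne_zero h.ne_zero) e1
  have e2 := mul_left_cancel₀ (inv_ne_zero h.ne_zero) e2
  refine mul_left_cancel₀ (mul_ne_zero (mul_ne_zero a1 a2) (mul_ne_zero a3 a4)) ?_
  linear_combination (b3 * b4 * N (cosetMk D x') (cosetMk D y')) * e1 -
    (b3 * b4 * M (cosetMk D x') (cosetMk D y')) * e2

theorem IsRankOne.apply_ne_zero_of_factorRel (hC : IsHomogeneous C) (hD : IsClosedSubset C D)
    (h : IsRankOne C D E ε) (hp : ∀ S, cosetMk D (p S) = S)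
    {M : Matrix (Cosets D) (Cosets D) ℂ} (hM : IsConst C (inflate E ε p M))
    {c : Set (X × X)} (hc : c ∈ C) {S T S' T' : Cosets D}
    (h1 : (S, T) ∈ factorRel D c) (h2 : (S', T') ∈ factorRel D c) (h0 : M S T ≠ 0) :
    M S' T' ≠ 0 := by
  obtain ⟨x, y, rfl, rfl, hxy⟩ := (mem_factorRel_iff hC hD).1 h1
  obtain ⟨x', y', rfl, rfl, hxy'⟩ := (mem_factorRel_iff hC hD).1 h2
  rwa [Ne, ← h.inflate_apply_eq_zero_iff hp, ← hM c hc _ _ _ _ hxy hxy',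
    h.inflate_apply_eq_zero_iff hp]

theorem IsRankOne.isConst_inflate_compress (hC : IsHomogeneous C) (h : IsRankOne C D E ε)
    (hp : ∀ S, cosetMk D (p S) = S) {M : Matrix X X ℂ} (hM : IsConst C M) :
    IsConst C (inflate E ε p (compress E ε p M)) := by
  rw [h.inflate_compress hp]
  exact (h.isConst.mul hC.toIsCoherent hM).mul hC.toIsCoherent h.isConst

theorem IsRankOne.mem_factorRel_of_compress_ne_zero (hC : IsHomogeneous C)
    (hD : IsClosedSubset C D) (h : IsRankOne C D E ε) (hp : ∀ S, cosetMk D (p S) = S)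
    {c : Set (X × X)} {S T : Cosets D} (h0 : compress E ε p (adj c) S T ≠ 0) :
    (S, T) ∈ factorRel D c := by
  obtain ⟨x, rfl⟩ := cosetMk_surjective S
  obtain ⟨y, rfl⟩ := cosetMk_surjective T
  rw [Ne, ← h.inflate_apply_eq_zero_iff hp, h.inflate_compress hp, Matrix.mul_apply] at h0
  obtain ⟨b, -, hb⟩ := Finset.exists_ne_zero_of_sum_ne_zero h0
  obtain ⟨a, -, ha⟩ := Finset.exists_ne_zero_of_sum_ne_zero (left_ne_zero_of_mul hb)
  replace ha : E x a * adj c a b ≠ 0 := ha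
  have hx : cosetMk D x = cosetMk D a := by
    by_contra hne
    exact ha (by rw [h.apply_eq_zero x a hne, zero_mul])
  have hy : cosetMk D b = cosetMk D y := by
    by_contra hne
    exact hb (by rw [h.apply_eq_zero b y hne, mul_zero])
  rw [mem_factorRel_iff hC hD]
  refine ⟨a, b, hx.symm, hy, ?_⟩
  by_contra hab
  exact ha (by rw [adj_apply, if_neg hab, mul_zero])

/-- The compression of `e ℂC e` is a subalgebra. -/
noncomputable def IsRankOne.subalgebra (hC : IsHomogeneous C) (h : IsRankOne C D E ε)
    (hp : ∀ S, cosetMk D (p S) = S) : Subalgebra ℂ (Matrix (Cosets D) (Cosets D) ℂ) where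
  carrier := {N | IsConst C (inflate E ε p N)}
  mul_mem' hM hN := by
    rw [Set.mem_ofPred_eq, h.inflate_mul hp]
    exact IsConst.mul hC.toIsCoherent hM hN
  add_mem' hM hN := by
    rw [Set.mem_ofPred_eq, inflate_add]
    exact IsConst.add hM hN
  algebraMap_mem' z := by
    rw [Algebra.algebraMap_eq_smul_one, Set.mem_ofPred_eq, inflate_smul, h.inflate_one hp]
    exact h.isConst.smul z

section Weight

variable {L : Type*} {c : L → Set (X × X)}

theorem IsRepresentatives.exists_mem (hC : IsHomogeneous C) (hD : IsClosedSubset C D)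
    (hc : IsRepresentatives C D E c) (q : Cosets D × Cosets D) : ∃ l, q ∈ factorRel D (c l) := by
  obtain ⟨r, ⟨hr, hq⟩, -⟩ := (isPartition_factor hC hD).2 q
  rw [hc.surj] at hr
  obtain ⟨l, rfl⟩ := hr
  exact ⟨l, hq⟩

/-- All `e A_d e` with the same class `d^D` are multiples of any nonzero one among them, and
admissibility makes the chosen one nonzero if any is. The ratio is read off at one nonzero entry. -/
theorem IsRankOne.compress_adj_mem_span (hC : IsHomogeneous C) (hD : IsClosedSubset C D)
    (h : IsRankOne C D E ε) (hp : ∀ S, cosetMk D (p S) = S) (hc : IsRepresentatives C D E c)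
    {d : Set (X × X)} (hd : d ∈ C) : compress E ε p (adj d) ∈
      Submodule.span ℂ (Set.range fun l => compress E ε p (adj (c l))) := by
  by_cases h0 : E * adj d * E = 0
  · rw [(h.compress_eq_zero_iff hp _).2 h0]
    exact Submodule.zero_mem _
  obtain ⟨l, hl⟩ : factorRel D d ∈ Set.range fun l => factorRel D (c l) := by
    rw [← hc.surj]
    exact ⟨d, hd, rfl⟩
  have hl : factorRel D (c l) = factorRel D d := hl
  have h1 := hc.ne_zero l ⟨d, hd, hl.symm, h0⟩
  rw [Ne, ← h.compress_eq_zero_iff hp] at h1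
  obtain ⟨S, T, hST⟩ : ∃ S T, compress E ε p (adj (c l)) S T ≠ 0 := by
    by_contra! h2
    exact h1 (Matrix.ext h2)
  have hmem := h.mem_factorRel_of_compress_ne_zero hC hD hp hST
  have key : compress E ε p (adj d) =
      (compress E ε p (adj d) S T / compress E ε p (adj (c l)) S T) •
        compress E ε p (adj (c l)) := by
    ext S' T'
    rw [Matrix.smul_apply, smul_eq_mul, div_mul_eq_mul_div, eq_div_iff hST]
    by_cases h3 : (S', T') ∈ factorRel D (c l)
    · exact h.mul_eq_mul_of_factorRel hC hD hp
        (h.isConst_inflate_compress hC hp (isConst_adj hC.partition hd))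
        (h.isConst_inflate_compress hC hp (isConst_adj hC.partition (hc.mem l))) (hc.mem l) h3 hmem
    · have z1 : compress E ε p (adj d) S' T' = 0 := by
        by_contra h4
        exact h3 (hl ▸ h.mem_factorRel_of_compress_ne_zero hC hD hp h4)
      have z2 : compress E ε p (adj (c l)) S' T' = 0 := by
        by_contra h4
        exact h3 (h.mem_factorRel_of_compress_ne_zero hC hD hp h4)
      rw [z1, z2, zero_mul, mul_zero]
  rw [key]
  exact Submodule.smul_mem _ _ (Submodule.subset_span ⟨l, rfl⟩)

variable [Fintype L]

theorem IsRankOne.sum_compress_apply (hC : IsHomogeneous C) (hD : IsClosedSubset C D)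
    (h : IsRankOne C D E ε) (hp : ∀ S, cosetMk D (p S) = S) (hc : IsRepresentatives C D E c)
    {l : L} {S T : Cosets D} (hl : (S, T) ∈ factorRel D (c l)) :
    (∑ l, compress E ε p (adj (c l))) S T = compress E ε p (adj (c l)) S T := by
  rw [Matrix.sum_apply]
  refine Finset.sum_eq_single l (fun l' _ hne => ?_) fun h => absurd (Finset.mem_univ _) h
  by_contra h0
  exact hne (hc.inj (factorRel_eq hC hD (hc.mem l') (hc.mem l)
    (h.mem_factorRel_of_compress_ne_zero hC hD hp h0) hl))

/-- The summands live on disjoint classes, and each is either zero or nowhere zero on its class. -/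
theorem IsRankOne.sum_compress_ne_zero (hC : IsHomogeneous C) (hD : IsClosedSubset C D)
    (h : IsRankOne C D E ε) (hp : ∀ S, cosetMk D (p S) = S) (hc : IsRepresentatives C D E c)
    {l : L} {S T : Cosets D} (hl : (S, T) ∈ factorRel D (c l)) :
    (∑ l, compress E ε p (adj (c l))) S T ≠ 0 ↔ E * adj (c l) * E ≠ 0 := by
  rw [h.sum_compress_apply hC hD hp hc hl, Ne, Ne, ← h.compress_eq_zero_iff hp]
  constructor
  · intro h0 h1
    rw [h1] at h0
    exact h0 rfl
  · intro h0
    obtain ⟨S', T', h1⟩ : ∃ S' T', compress E ε p (adj (c l)) S' T' ≠ 0 := by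
      by_contra! h1
      exact h0 (Matrix.ext h1)
    exact h.apply_ne_zero_of_factorRel hC hD hp
      (h.isConst_inflate_compress hC hp (isConst_adj hC.partition (hc.mem l))) (hc.mem l)
      (h.mem_factorRel_of_compress_ne_zero hC hD hp h1) hl h1

theorem IsRankOne.hadamard_sum_compress (hC : IsHomogeneous C) (hD : IsClosedSubset C D)
    (h : IsRankOne C D E ε) (hp : ∀ S, cosetMk D (p S) = S) (hc : IsRepresentatives C D E c)
    (l : L) : Matrix.hadamard (adj (factorRel D (c l))) (∑ l, compress E ε p (adj (c l))) =
      compress E ε p (adj (c l)) := by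
  ext S T
  rw [Matrix.hadamard_apply, adj_apply]
  split_ifs with hl
  · rw [one_mul, h.sum_compress_apply hC hD hp hc hl]
  · rw [zero_mul]
    by_contra h0
    exact hl (h.mem_factorRel_of_compress_ne_zero hC hD hp (Ne.symm h0))

theorem IsRankOne.isWeight (hC : IsHomogeneous C) (hD : IsClosedSubset C D)
    (h : IsRankOne C D E ε) (hp : ∀ S, cosetMk D (p S) = S) (hc : IsRepresentatives C D E c) :
    IsWeight (factor C D) (∑ l, compress E ε p (adj (c l))) where
  spt_eq := by
    refine ⟨{r | ∃ l, factorRel D (c l) = r ∧ E * adj (c l) * E ≠ 0}, ?_, ?_⟩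
    · rintro _ ⟨l, rfl, -⟩
      exact ⟨c l, hc.mem l, rfl⟩
    · ext ⟨S, T⟩
      obtain ⟨l, hl⟩ := hc.exists_mem hC hD (S, T)
      refine (h.sum_compress_ne_zero hC hD hp hc hl).trans ⟨fun h0 => ⟨_, ⟨l, rfl, h0⟩, hl⟩, ?_⟩
      rintro ⟨_, ⟨l', rfl, h0⟩, hl'⟩
      rwa [hc.inj (factorRel_eq hC hD (hc.mem l) (hc.mem l') hl hl')]
  spt_transp := by
    intro d hd hsub
    obtain ⟨l, rfl⟩ : d ∈ Set.range fun l => factorRel D (c l) := hc.surj ▸ hd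
    obtain ⟨⟨S, T⟩, hST⟩ := Setoid.nonempty_of_mem_partition (isPartition_factor hC hD) hd
    have h0 := (h.sum_compress_ne_zero hC hD hp hc hST).1 (hsub hST)
    rintro ⟨S', T'⟩ hp'
    obtain ⟨l', hl'⟩ := hc.exists_mem hC hD (S', T')
    have htr := hC.transp_mem _ (hc.mem l)
    refine (h.sum_compress_ne_zero hC hD hp hc hl').2 (hc.ne_zero l' ⟨transp (c l), htr, ?_, ?_⟩)
    · exact factorRel_eq hC hD htr (hc.mem l') (transp_factorRel D (c l) ▸ hp') hl'
    · intro h1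
      -- Since `e` is Hermitian, the adjoint of `e A_c e` is `e` times the transpose of `A_c` times
      -- `e`.
      refine h0 (Matrix.conjTranspose_eq_zero.1 ?_)
      rw [Matrix.conjTranspose_mul, Matrix.conjTranspose_mul, h.conjTranspose_eq, ← adj_transp,
        ← Matrix.mul_assoc, h1]
  diag_ne := by
    intro S
    obtain ⟨l, hl⟩ := hc.exists_mem hC hD (S, S)
    refine (h.sum_compress_ne_zero hC hD hp hc hl).2
      (hc.ne_zero l ⟨_, hC.diagonal_mem, ?_, ?_⟩)
    · refine factorRel_eq hC hD hC.diagonal_mem (hc.mem l) ?_ hl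
      rw [factorRel_diagonal hC hD]
      exact rfl
    · have h1 : adj (Set.diagonal X) = 1 := by
        ext x y
        simp [adj_apply, Matrix.one_apply]
      rw [h1, Matrix.mul_one, h.idem]
      exact fun h2 => h.ne_zero (by rw [← h.apply_self (p S), h2]; rfl)
  algebra := by
    have himage : (fun d => Matrix.hadamard (adj d) (∑ l, compress E ε p (adj (c l)))) ''
        factor C D = Set.range fun l => compress E ε p (adj (c l)) := by
      rw [hc.surj, ← Set.range_comp]
      exact congrArg Set.range (funext fun l => h.hadamard_sum_compress hC hD hp hc l)
    rw [himage]
    -- Every element of the subalgebra is the compression of its inflation, which lies in `ℂC`; by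
    -- linearity only the matrices `A_d` need to be treated.
    refine ⟨h.subalgebra hC hp, le_antisymm ?_ (Submodule.span_le.2 ?_)⟩
    · intro N hN
      have hN : IsConst C (inflate E ε p N) := hN
      rw [← mem_span_adj_iff hC.partition] at hN
      rw [← h.compress_inflate hp N]
      generalize inflate E ε p N = M at hN
      induction hN using Submodule.span_induction with
      | mem M hM =>
        obtain ⟨d, hd, rfl⟩ := hM
        exact h.compress_adj_mem_span hC hD hp hc hd
      | zero =>
        rw [(h.compress_eq_zero_iff hp 0).2 (by simp)]
        exact Submodule.zero_mem _
      | add M N _ _ hM hN =>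
        rw [compress_add]
        exact Submodule.add_mem _ hM hN
      | smul z M _ hM =>
        rw [compress_smul]
        exact Submodule.smul_mem _ _ hM
    · rintro _ ⟨l, rfl⟩
      exact h.isConst_inflate_compress hC hp (isConst_adj hC.partition (hc.mem l))

end Weight

end FactorWeight

end CohConf

theorem mainTheorem3 {X : Type*} [Fintype X] [DecidableEq X]
    (C D : Set (Set (X × X)))
    (hC : CohConf.IsHomogeneous C) (hD : CohConf.IsClosedSubset C D)
    (φ : CohConf.adjAlgebra D → ℂ) (hφ : CohConf.IsIrreducibleCharacter φ)
    (x₀ : X) (hm : CohConf.HasMultiplicity D x₀ φ 1) :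
    CohConf.IsHomogeneous (CohConf.factor C D) ∧
    ∃ e : CohConf.adjAlgebra D,
      (∀ e' : CohConf.adjAlgebra D, CohConf.IsIdempotentOf φ e' ↔ e' = e) ∧
      (∃ ℓ : ℕ, Nonempty (CohConf.Frame D (e : Matrix X X ℂ) ℓ)) ∧
      ∀ (ℓ : ℕ) (F : CohConf.Frame D (e : Matrix X X ℂ) ℓ),
        F.GammaIsAlgHom ∧
        ∀ {L : Type*} [Fintype L] (c : L → Set (X × X)),
          CohConf.IsRepresentatives C D (e : Matrix X X ℂ) c →
          CohConf.IsWeight (CohConf.factor C D)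
            (∑ l, F.gamma ((e : Matrix X X ℂ) * CohConf.adj (c l) * (e : Matrix X X ℂ))) := by
  obtain ⟨n, ρ, hρ, haff, hrank⟩ := hm
  have hn : n = 1 := le_antisymm (hrank ▸ hρ.le_finrank hC hD x₀) (Nat.pos_of_ne_zero hρ.1)
  subst hn
  obtain ⟨e, he, hcomm, h1, hk, hh⟩ := CohConf.exists_idempotent (CohConf.adjAlgebra D)
    (fun _ => CohConf.conjTranspose_mem_adjAlgebra hC hD) ρ
  obtain ⟨ε, h⟩ := CohConf.exists_isRankOne hC hD he h1 hk hh x₀ hrank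
  refine ⟨CohConf.isHomogeneous_factor hC hD, e, hρ.isIdempotentOf_iff haff he hcomm h1 hk,
    h.exists_frame hC hD x₀, fun ℓ F => ?_⟩
  -- Any position would serve; the point `x₀` shows that one exists.
  let i : Fin ℓ := (F.order (CohConf.cosetMk D x₀)).symm
    ⟨x₀, CohConf.mem_coset_self hC.toIsCoherent hD x₀⟩
  refine ⟨F.gammaIsAlgHom hC hD h i, fun c hc => ?_⟩
  have hgamma : ∀ l, F.gamma ((e : Matrix X X ℂ) * CohConf.adj (c l) * (e : Matrix X X ℂ)) =
      CohConf.compress (e : Matrix X X ℂ) ε (fun S => (F.order S i : X)) (CohConf.adj (c l)) := by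
    intro l
    rw [F.gamma_eq hC hD h i, h.compress_mul_mul]
    rw [Matrix.mul_assoc, Matrix.mul_assoc _ (e : Matrix X X ℂ), h.idem, ← Matrix.mul_assoc,
      ← Matrix.mul_assoc, h.idem]
  simp only [hgamma]
  exact h.isWeight hC hD (fun S => F.cosetMk_order hC hD S i) hc
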